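/- Let $\Sigma=\{1,\dots,\sigma\}$ and let $w\in\Sigma^*$ be a word of length $n$, where $1\le\sigma\le n$; $w[j+1:i]$ denotes the factor of $w$ from position $j+1$ to position $i$. A word $v\in\Sigma^*$ is a \emph{minimal absent subsequence} (MAS) of $w$ if $v$ is not a (scattered) subsequence of $w$ but every proper subsequence of $v$ is. Let $\mathcal D_w$ be the directed graph with nodes $\{(i,j)\mid 0\le j<i\le n\}\cup\{(0,0),f\}$ and the following edges, labelled by letters of $\Sigma$: \begin{itemize} \item $(0,0)\to(i,0)$ with label $a$, if $i$ is the first position of $w$ at which $a$ occurs; \item $(i,j)\to(k,i)$ with label $a$, for $j<i$, if $a$ occurs in $w[j+1:i]$ and $k$ is the first position greater than $i$ at which $a$ occurs; \item $(i,j)\to f$ with label $b$, for $j<i$, if $b$ occurs in $w[j+1:i]$ but not in $w[i+1:n]$; \item $(0,0)\to f$ with label $a$, if $a\in\Sigma$ does not occur in $w$ (there is no such edge if all letters of $\Sigma$ occur in $w$). \end{itemize} Then $\mathcal D_w$ is acyclic, and reading the labels along a path is a bijection from the set of paths from $(0,0)$ to $f$ onto the set of all MAS of $w$. Moreover, on a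 unit-cost RAM with words of logarithmic size (at least $c\log n$ bits for a constant $c$), there are algorithms, independent of $w$ and $\sigma$, such that, given $w$ and $\sigma$, one can construct in $O(n^2\sigma)$ time data structures that contain $\mathcal D_w$, stored as an $(n+1)\times(n+1)\times\sigma$ table of edges, and with which the following tasks can be performed, any number of times: \begin{enumerate} \item check, in $O(m)$ time (meaning at most $C(m+1)$ steps), whether a given word $u\in\Sigma^*$ of length $m$ is an MAS of $w$; \item compute, in time polynomial in $n$, an MAS of $w$ of maximal length; \item decide, in time polynomial in $n$, whether $w$ has an MAS of a given length $\ell$; \item enumerate all MAS of $w$, each exactly once, with polynomial delay: the time before the first MAS is completed, between two consecutive ones, and from the last one to the end of the computation is polynomial in $n$. \end{enumerate} -/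

import Mathlib

namespace MASRep

/-! ### Minimal absent subsequences -/

/-- `v` is a minimal absent subsequence of `w`: it is not a subsequence of `w`, but each of its
proper subsequences is. -/
def IsMAS {σ : ℕ} (w v : List (Fin σ)) : Prop :=
  ¬ List.Sublist v w ∧ ∀ u : List (Fin σ), List.Sublist u v → u ≠ v → List.Sublist u w

/-! ### The labelled graph of a word -/

/-- The factor `w[j+1 : i]`, with positions counted from `1`. -/
def factor {σ : ℕ} (w : List (Fin σ)) (j i : ℕ) : List (Fin σ) := (w.take i).drop j

/-- `k` is the leftmost position of `w` (counted from `1`) that is larger than `i` and carries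
the letter `a`. -/
def IsNext {σ : ℕ} (w : List (Fin σ)) (i : ℕ) (a : Fin σ) (k : ℕ) : Prop :=
  i < k ∧ w[k - 1]? = some a ∧ ∀ l, i < l → l < k → w[l - 1]? ≠ some a

/-- Nodes: pairs of positions, and the sink. -/
inductive Node where
  | pos (i j : ℕ) : Node
  | sink : Node

/-- The pairs that are nodes of the graph of a word of length `n`. -/
def IsPair (n i j : ℕ) : Prop := (j < i ∧ i ≤ n) ∨ (i = 0 ∧ j = 0)

/-- `Edge w x a y`: the graph of `w` has an edge from `x` to `y` with label `a`. Edges of type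
`absent` are there only if some letter of the alphabet does not occur in `w`. -/
inductive Edge {σ : ℕ} (w : List (Fin σ)) : Node → Fin σ → Node → Prop
  | start (a : Fin σ) (i : ℕ) : IsNext w 0 a i → Edge w (.pos 0 0) a (.pos i 0)
  | step (i j : ℕ) (a : Fin σ) (k : ℕ) : j < i → a ∈ factor w j i → IsNext w i a k →
      Edge w (.pos i j) a (.pos k i)
  | final (i j : ℕ) (b : Fin σ) : j < i → i ≤ w.length → b ∈ factor w j i →
      b ∉ factor w i w.length → Edge w (.pos i j) b .sink
  | absent (a : Fin σ) : a ∉ w → Edge w (.pos 0 0) a .sink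

/-- A path from `x` to `y`, given as the list of the labels and end nodes of its edges. -/
def IsPath {σ : ℕ} (w : List (Fin σ)) : Node → List (Fin σ × Node) → Node → Prop
  | x, [], y => x = y
  | x, (a, z) :: p, y => Edge w x a z ∧ IsPath w z p y

/-- The word read along a path. -/
def label {σ : ℕ} (p : List (Fin σ × Node)) : List (Fin σ) := p.map Prod.fst

/-- There is no closed path of positive length. -/
def IsAcyclic {σ : ℕ} (w : List (Fin σ)) : Prop :=
  ∀ (x : Node) (p : List (Fin σ × Node)), IsPath w x p x → p = []

/-- The array `D` is a table of the graph of `w`, an `(n+1) × (n+1) × σ` array stored row by row: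
for a node `(i, j)` and a letter `a`, the entry `D[i][j][a]` is `k` if there is an edge with label
`a` from `(i, j)` to `(k, i)`, it is `n + 1` if there is one to the sink, and `0` otherwise. -/
def StoresGraph {σ : ℕ} (w : List (Fin σ)) (D : ℕ → ℕ) : Prop :=
  ∀ (i j : ℕ) (a : Fin σ), IsPair w.length i j →
    D ((i * (w.length + 1) + j) * σ + a) ≤ w.length + 1 ∧
    (∀ k, 1 ≤ k → k ≤ w.length →
      (D ((i * (w.length + 1) + j) * σ + a) = k ↔ Edge w (.pos i j) a (.pos k i))) ∧
    (D ((i * (w.length + 1) + j) * σ + a) = w.length + 1 ↔ Edge w (.pos i j) a .sink)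

/-! ### A unit-cost random access machine with bounded words

The machine has registers and arrays of words; a word is a natural number below a bound `W` (so it
has `log W` bits), and a computation in which a larger number would arise is stuck. Every operation
on words, every access to a register or an array cell with a computed index, every test, and every
output of a word takes one unit of time. Control flow is structured. A program mentions finitely
many registers and arrays, so that these could as well be interleaved in a single memory. -/

/-- Names of arrays. A program that answers queries has to keep the arrays `input` and `data`. -/
inductive Arr where
  | input : Arr
  | query : Arr
  | data (k : ℕ) : Arr
  | work (k : ℕ) : Arr
  deriving DecidableEq

inductive Op where
  | add | sub | mul | div | mod | lt | eq

/-- Subtraction is truncated at `0`, division rounds down, tests return `1` or `0`. -/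
def Op.apply : Op → ℕ → ℕ → ℕ
  | .add, x, y => x + y
  | .sub, x, y => x - y
  | .mul, x, y => x * y
  | .div, x, y => x / y
  | .mod, x, y => x % y
  | .lt, x, y => if x < y then 1 else 0
  | .eq, x, y => if x = y then 1 else 0

inductive Expr where
  | const (c : ℕ) : Expr
  | reg (x : ℕ) : Expr
  | read (A : Arr) (e : Expr) : Expr
  | op (o : Op) (e₁ e₂ : Expr) : Expr

inductive Cmd where
  | skip : Cmd
  /-- register `x` gets the value of `e` -/
  | assign (x : ℕ) (e : Expr) : Cmd
  /-- cell `i` of the array `A` gets the value of `e` -/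
  | store (A : Arr) (i e : Expr) : Cmd
  | output (e : Expr) : Cmd
  | seq (c₁ c₂ : Cmd) : Cmd
  /-- `c₁` if the value of `e` is not `0`, else `c₂` -/
  | cond (e : Expr) (c₁ c₂ : Cmd) : Cmd
  /-- repeat `c` as long as the value of `e` is not `0` -/
  | loop (e : Expr) (c : Cmd) : Cmd

/-- The registers and arrays, and two records that a program cannot read: the time spent so far and
the words written to the output so far, each with the time at which it was written. -/
structure State where
  reg : ℕ → ℕ
  arr : Arr → ℕ → ℕ
  clock : ℕ
  out : List (ℕ × ℕ)

/-- A number, if it fits into a word. -/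
def word (W x : ℕ) : Option ℕ := if x < W then some x else none

def Expr.eval (W : ℕ) (s : State) : Expr → Option ℕ
  | .const c => word W c
  | .reg x => word W (s.reg x)
  | .read A e => (e.eval W s).bind fun i => word W (s.arr A i)
  | .op o e₁ e₂ => (e₁.eval W s).bind fun x => (e₂.eval W s).bind fun y => word W (o.apply x y)

/-- The time for the evaluation of an expression: the number of its operations and accesses. -/
def Expr.cost : Expr → ℕ
  | .const _ => 1
  | .reg _ => 1
  | .read _ e => e.cost + 1
  | .op _ e₁ e₂ => e₁.cost + e₂.cost + 1

def State.tick (s : State) (t : ℕ) : State := { s with clock := s.clock + t }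

/-- `Exec W c s s'`: on words below `W`, the program `c` started in the state `s` runs without
overflow and halts in the state `s'`. -/
inductive Exec (W : ℕ) : Cmd → State → State → Prop
  | skip (s : State) : Exec W .skip s (s.tick 1)
  | assign (s : State) (x : ℕ) (e : Expr) (v : ℕ) : e.eval W s = some v →
      Exec W (.assign x e) s
        { s with reg := Function.update s.reg x v, clock := s.clock + (e.cost + 1) }
  | store (s : State) (A : Arr) (i e : Expr) (k v : ℕ) :
      i.eval W s = some k → e.eval W s = some v →
      Exec W (.store A i e) s
        { s with
          arr := Function.update s.arr A (Function.update (s.arr A) k v)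
          clock := s.clock + (i.cost + e.cost + 1) }
  | output (s : State) (e : Expr) (v : ℕ) : e.eval W s = some v →
      Exec W (.output e) s
        { s with
          clock := s.clock + (e.cost + 1)
          out := s.out ++ [(s.clock + (e.cost + 1), v)] }
  | seq (c₁ c₂ : Cmd) (s s' s'' : State) :
      Exec W c₁ s s' → Exec W c₂ s' s'' → Exec W (.seq c₁ c₂) s s''
  | cond_true (e : Expr) (c₁ c₂ : Cmd) (s s' : State) (v : ℕ) :
      e.eval W s = some v → v ≠ 0 → Exec W c₁ (s.tick (e.cost + 1)) s' →
      Exec W (.cond e c₁ c₂) s s'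
  | cond_false (e : Expr) (c₁ c₂ : Cmd) (s s' : State) :
      e.eval W s = some 0 → Exec W c₂ (s.tick (e.cost + 1)) s' →
      Exec W (.cond e c₁ c₂) s s'
  | loop_true (e : Expr) (c : Cmd) (s s' s'' : State) (v : ℕ) :
      e.eval W s = some v → v ≠ 0 → Exec W c (s.tick (e.cost + 1)) s' →
      Exec W (.loop e c) s' s'' → Exec W (.loop e c) s s''
  | loop_false (e : Expr) (c : Cmd) (s : State) :
      e.eval W s = some 0 → Exec W (.loop e c) s (s.tick (e.cost + 1))

/-! ### Input and output -/

/-- The letters are the numbers `1, …, σ`. -/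
def code {σ : ℕ} (v : List (Fin σ)) : List ℕ := v.map fun a => (a : ℕ) + 1

/-- The array that starts with the given list and continues with zeros. -/
def load (l : List ℕ) : ℕ → ℕ := fun i => l.getD i 0

/-- The word `w`, preceded by its length and the size of the alphabet. -/
def inputArray {σ : ℕ} (w : List (Fin σ)) : ℕ → ℕ := load (w.length :: σ :: code w)

/-- The initial state for the input `w`. -/
def initial {σ : ℕ} (w : List (Fin σ)) : State where
  reg := fun _ => 0
  arr := fun A => if A = .input then inputArray w else fun _ => 0
  clock := 0
  out := []

/-- `s'` has the same input word and the same data structures as `s`. -/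
def SameData (s s' : State) : Prop :=
  s'.arr .input = s.arr .input ∧ ∀ k, s'.arr (.data k) = s.arr (.data k)

/-- A state `s` in which a query to the data structures in `s₁` may start. The registers and the
arrays `work` may hold anything, for example what earlier queries have left there. -/
def IsQueryStart (s₁ s : State) : Prop := SameData s₁ s ∧ s.clock = 0 ∧ s.out = []

/-- On words below `W`, the program `c` started in `s` halts in a state that satisfies `Q`, and it
leaves the input word and the data structures as they were. -/
def Answers (W : ℕ) (c : Cmd) (s : State) (Q : State → Prop) : Prop :=
  ∃ s' : State, Exec W c s s' ∧ SameData s s' ∧ Q s'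

/-- The words on the output. -/
def State.written (s : State) : List ℕ := s.out.map Prod.snd

/-- The output is the truth value of `P`. -/
def State.Decides (s : State) (P : Prop) : Prop :=
  (P ∧ s.written = [1]) ∨ (¬ P ∧ s.written = [0])

/-- The output consists of the elements of `S`, each of them once and followed by the end mark `0`,
and the time until the first end mark, between consecutive ones, and from the last one
to the end of the computation is at most `d`. -/
def State.Enumerates {σ : ℕ} (s : State) (S : Set (List (Fin σ))) (d : ℕ) : Prop :=
  (∃ L : List (List (Fin σ)), L.Nodup ∧ (∀ v, v ∈ L ↔ v ∈ S) ∧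
    s.written = L.flatMap fun v => code v ++ [0]) ∧
  List.IsChain (fun t t' => t' ≤ t + d)
    (0 :: (s.out.filter fun p => p.2 = 0).map Prod.fst ++ [s.clock])

end MASRep

/-! Read a word greedily in `w`. Let `i` be the position where the embedding of a nonempty prefix
ends, and `j` the position reached before its last letter. A continuation `u` completes the prefix
to an MAS exactly if `u` is an MAS of `w[i+1:n]` and, because the last letter of the prefix must be
indispensable, `u` is a subsequence of `w[j+1:n]`. This is `Good w i j u`; at the source the second
condition is void.

The combinatorial core is `good_cons_iff`. If the first letter `a` of `u` did not occur in
`w[j+1:i]`, an embedding of `u` into `w[j+1:n]` would lie inside `w[i+1:n]`, where `u` is absent. So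
`a` occurs in `w[j+1:i]`, and the reading moves to the next `a` after `i`, or ends if there is none.
By `edge_iff` these are exactly the edges, so the labels of the paths from `(i, j)` to the sink are
the good words. A node has at most one edge per letter, which makes the labelling injective; the
first coordinate increases along edges, which excludes cycles.

The algorithms use only the function `target`, tabulated with constant time per entry from a table
of next occurrences. Testing a word means following its path. Lengths are handled by dynamic
programming over triples (remaining length, `i`, `j`), with the recursion `ext_succ_iff`.
Enumeration is a depth-first search: there are no dead ends (`exists_target_ne_zero`), so each
visited node yields output, and between two outputs the search only climbs one branch and descends
another, each of length linear in `n`; `visits` turns this into a bound on the delay. Programs are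
verified with rules for total correctness (`Ends`) that carry overflow checks and time bounds along
with the invariants. -/

namespace MASRep

/-! ### The combinatorics of minimal absent subsequences -/

section Words

variable {σ : ℕ}

/-- The first position after `i` that carries `a`, or `w.length + 1` if there is none. -/
def nextPos (w : List (Fin σ)) (i : ℕ) (a : Fin σ) : ℕ := i + (w.drop i).idxOf a + 1

/-- The target of the edge with label `a` out of `(i, j)`, encoded as in `StoresGraph`. -/
def target (w : List (Fin σ)) (i j : ℕ) (a : Fin σ) : ℕ :=
  if i = 0 ∨ nextPos w j a ≤ i then nextPos w i a else 0

/-- `u` is the label of a path from `(i, j)` to the sink. -/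
def Good (w : List (Fin σ)) (i j : ℕ) (u : List (Fin σ)) : Prop :=
  IsMAS (w.drop i) u ∧ (i = 0 ∨ List.Sublist u (w.drop j))

theorem good_zero {w u : List (Fin σ)} : Good w 0 0 u ↔ IsMAS w u := by simp [Good]

theorem not_good_nil {w : List (Fin σ)} {i j : ℕ} : ¬ Good w i j [] := by simp [Good, IsMAS]

theorem lt_nextPos (w : List (Fin σ)) (i : ℕ) (a : Fin σ) : i < nextPos w i a := by
  unfold nextPos; omega

theorem nextPos_le {w : List (Fin σ)} {i : ℕ} (hi : i ≤ w.length) (a : Fin σ) :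
    nextPos w i a ≤ w.length + 1 := by
  have := List.idxOf_le_length (a := a) (l := w.drop i)
  rw [List.length_drop] at this
  unfold nextPos; omega

theorem nextPos_length (w : List (Fin σ)) (a : Fin σ) : nextPos w w.length a = w.length + 1 := by
  simp [nextPos]

theorem nextPos_eq_ite {w : List (Fin σ)} {i : ℕ} (hi : i < w.length) (a : Fin σ) :
    nextPos w i a = if w[i] = a then i + 1 else nextPos w (i + 1) a := by
  unfold nextPos
  rw [List.drop_eq_getElem_cons hi, List.idxOf_cons]
  by_cases h : w[i] = a
  · simp [h]
  · have : (w[i] == a) = false := by simpa using h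
    simp only [this, cond_false, h, if_false]; omega

theorem target_le {w : List (Fin σ)} {i : ℕ} (hi : i ≤ w.length) (j : ℕ) (a : Fin σ) :
    target w i j a ≤ w.length + 1 := by
  unfold target; split_ifs
  · exact nextPos_le hi a
  · omega

theorem mem_drop_iff {w : List (Fin σ)} {i : ℕ} (hi : i ≤ w.length) {a : Fin σ} :
    a ∈ w.drop i ↔ nextPos w i a ≤ w.length := by
  rw [← List.idxOf_lt_length_iff, List.length_drop, nextPos]; omega

/-- `List.idxOf` is minimal, and equals the length for a missing element; the bound on `k` excludes
that default. Positions count from `1` and list indices from `0`, hence the shifts by one. -/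
theorem isNext_iff {w : List (Fin σ)} {i : ℕ} (hi : i ≤ w.length) {a : Fin σ} {k : ℕ} :
    IsNext w i a k ↔ nextPos w i a = k ∧ k ≤ w.length := by
  have key : ∀ l, i < l → l < nextPos w i a → w[l - 1]? ≠ some a := by
    intro l h1 h2 h3
    have h4 : (w.drop i)[l - 1 - i]? = some a := by
      rw [List.getElem?_drop, ← h3]; congr 1; omega
    obtain ⟨h5, h6⟩ := List.getElem?_eq_some_iff.1 h4
    have : (w.drop i).idxOf a ≤ l - 1 - i := by
      by_contra h7
      have := List.not_of_lt_findIdx (p := (· == a)) (xs := w.drop i) (i := l - 1 - i)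
        (by simpa [List.idxOf] using h7)
      simp [h6] at this
    unfold nextPos at h2; omega
  have key2 : nextPos w i a ≤ w.length → w[nextPos w i a - 1]? = some a := by
    intro h
    have h1 := (mem_drop_iff hi).2 h
    have h2 := List.getElem?_idxOf h1
    rw [List.getElem?_drop] at h2
    rw [← h2]; rfl
  constructor
  · rintro ⟨h1, h2, h3⟩
    have hk : k ≤ w.length := by
      have := (List.getElem?_eq_some_iff.1 h2).1; omega
    refine ⟨?_, hk⟩
    rcases lt_trichotomy (nextPos w i a) k with h | h | h
    · exact absurd (key2 (by omega)) (h3 _ (lt_nextPos w i a) h)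
    · exact h
    · exact absurd h2 (key k h1 h)
  · rintro ⟨rfl, h⟩
    exact ⟨lt_nextPos w i a, key2 h, key⟩

theorem mem_factor_iff {w : List (Fin σ)} {i j : ℕ} (hj : j < i) (hi : i ≤ w.length) {a : Fin σ} :
    a ∈ factor w j i ↔ nextPos w j a ≤ i := by
  constructor
  · intro ha
    obtain ⟨l, hl, rfl⟩ := List.mem_iff_getElem.1 ha
    simp only [factor, List.length_drop, List.length_take] at hl
    have h1 : w[j + l]? = some (factor w j i)[l] := by
      simp [factor, List.getElem?_eq_getElem (show j + l < w.length by omega)]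
    by_contra h2
    rcases Nat.lt_or_ge w.length (nextPos w j (factor w j i)[l]) with h3 | h3
    · have := (mem_drop_iff (a := (factor w j i)[l]) (show j ≤ w.length by omega)).1
        (List.mem_of_getElem? (i := l) (by rw [List.getElem?_drop, h1]))
      omega
    · exact ((isNext_iff (show j ≤ w.length by omega)).2 ⟨rfl, h3⟩).2.2 (j + l + 1) (by omega)
        (by omega) (by simpa using h1)
  · intro h
    have h1 := (isNext_iff (show j ≤ w.length by omega)).2 ⟨rfl, h.trans hi⟩
    have h2 := lt_nextPos w j a
    refine List.mem_of_getElem? (i := nextPos w j a - 1 - j) ?_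
    rw [factor, List.getElem?_drop, List.getElem?_take_of_lt (by omega), ← h1.2.1]
    congr 1; omega

theorem drop_eq_factor_append {w : List (Fin σ)} {i j : ℕ} (hj : j ≤ i) (hi : i ≤ w.length) :
    w.drop j = factor w j i ++ w.drop i := by
  rw [factor]
  conv_lhs => rw [← List.take_append_drop i w]
  rw [List.drop_append_of_le_length (by simp; omega)]

/-- Greedy embedding of the first letter. -/
theorem cons_sublist_drop_iff {w : List (Fin σ)} {i : ℕ} (hi : i ≤ w.length) {a : Fin σ}
    {u : List (Fin σ)} :
    List.Sublist (a :: u) (w.drop i) ↔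
      nextPos w i a ≤ w.length ∧ List.Sublist u (w.drop (nextPos w i a)) := by
  induction h : w.length - i generalizing i with
  | zero =>
    obtain rfl : i = w.length := by omega
    simp [nextPos_length]
  | succ m ih =>
    have hi' : i < w.length := by omega
    rw [nextPos_eq_ite hi', List.drop_eq_getElem_cons hi']
    split_ifs with h1
    · subst h1
      rw [List.cons_sublist_cons]
      exact ⟨fun h2 => ⟨hi', h2⟩, fun h2 => h2.2⟩
    · rw [← ih (by omega) (by omega)]
      constructor
      · intro h2
        cases h2 with
        | cons _ h2 => exact h2
        | cons_cons _ h2 => exact absurd rfl h1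
      · exact fun h2 => h2.cons _

/-- A proper subsequence of `a :: u` either drops `a`, and is then a subsequence of `u`, or keeps
`a` and shortens `u`. In the second case the greedy embedding spends `w` up to the next `a`, and the
question becomes one about the remaining suffix. -/
theorem isMAS_drop_cons_iff {w : List (Fin σ)} {i : ℕ} (hi : i ≤ w.length) {a : Fin σ}
    {u : List (Fin σ)} :
    IsMAS (w.drop i) (a :: u) ↔
      (nextPos w i a = w.length + 1 ∧ u = []) ∨
      (nextPos w i a ≤ w.length ∧ IsMAS (w.drop (nextPos w i a)) u ∧ List.Sublist u (w.drop i)) := by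
  have hle := nextPos_le hi a
  constructor
  · rintro ⟨h1, h2⟩
    rw [cons_sublist_drop_iff hi] at h1
    rcases Nat.lt_or_ge w.length (nextPos w i a) with h | h
    · left
      refine ⟨by omega, ?_⟩
      by_contra hu
      have := h2 [a] (by simp) (by simpa using Ne.symm hu)
      rw [cons_sublist_drop_iff hi] at this
      omega
    · right
      refine ⟨h, ⟨fun h3 => h1 ⟨h, h3⟩, fun v hv hne => ?_⟩, h2 u (List.sublist_cons_self a u)
        fun h3 => by simpa using congrArg List.length h3⟩
      have := h2 (a :: v) (hv.cons_cons a) (by simpa using hne)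
      exact ((cons_sublist_drop_iff hi).1 this).2
  · rintro (⟨h1, rfl⟩ | ⟨h1, h2, h3⟩)
    · refine ⟨fun h => ?_, fun v hv hne => ?_⟩
      · rw [cons_sublist_drop_iff hi] at h; omega
      · rcases List.sublist_singleton.1 hv with rfl | rfl
        · simp
        · exact absurd rfl hne
    · refine ⟨fun h => h2.1 ((cons_sublist_drop_iff hi).1 h).2, fun v hv hne => ?_⟩
      cases hv with
      | cons _ hv => exact hv.trans h3
      | cons_cons _ hv =>
        rename_i v
        rw [cons_sublist_drop_iff hi]
        exact ⟨h1, h2.2 v hv fun h => hne (by rw [h])⟩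

/-! ### The recursion of good words along the edges. -/

theorem target_bounds {w : List (Fin σ)} {i j : ℕ} {a : Fin σ} (h : target w i j a ≠ 0) :
    i < target w i j a := by
  unfold target at *
  split_ifs at * with h1
  · exact lt_nextPos w i a
  · exact absurd rfl h

theorem IsPair.le {n i j : ℕ} (h : IsPair n i j) : i ≤ n ∧ j ≤ n := by
  unfold IsPair at h; omega

theorem IsPair.target {w : List (Fin σ)} {i j : ℕ} {a : Fin σ} (h : target w i j a ≠ 0)
    (h' : target w i j a ≤ w.length) : IsPair w.length (target w i j a) i :=
  Or.inl ⟨target_bounds h, h'⟩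

/-- The condition that `u` embeds after `i`, which comes from deleting `a`, is the second half of
goodness at the next node. The condition that `a :: u` embeds after `j` then reduces to an
occurrence of `a` in `w[j+1:i]`. -/
theorem good_cons_iff {w : List (Fin σ)} {i j : ℕ} (hp : IsPair w.length i j) {a : Fin σ}
    {u : List (Fin σ)} :
    Good w i j (a :: u) ↔ (target w i j a = w.length + 1 ∧ u = []) ∨
      (target w i j a ≠ 0 ∧ target w i j a ≤ w.length ∧ Good w (target w i j a) i u) := by
  have hi := hp.le.1
  have hj := hp.le.2
  have hlt := lt_nextPos w i a
  have hle := nextPos_le hi a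
  rw [Good, isMAS_drop_cons_iff hi]
  rcases hp with ⟨hji, _⟩ | ⟨rfl, rfl⟩
  · have hi0 : i ≠ 0 := by omega
    by_cases hf : nextPos w j a ≤ i
    · have ht : target w i j a = nextPos w i a := by simp [target, hf]
      rw [ht, Good]
      have hcons : List.Sublist u (w.drop i) → List.Sublist (a :: u) (w.drop j) := by
        intro h
        rw [drop_eq_factor_append hji.le hi]
        exact (List.singleton_sublist.2 ((mem_factor_iff hji hi).2 hf)).append h
      constructor
      · rintro ⟨h | ⟨h1, h2, h3⟩, -⟩
        · exact Or.inl h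
        · exact Or.inr ⟨by omega, h1, h2, Or.inr h3⟩
      · rintro (⟨h1, rfl⟩ | ⟨h1, h2, h3, h4⟩)
        · exact ⟨Or.inl ⟨h1, rfl⟩, Or.inr (hcons (by simp))⟩
        · have h5 := h4.resolve_left (by omega)
          exact ⟨Or.inr ⟨h2, h3, h5⟩, Or.inr (hcons h5)⟩
    · have ht : target w i j a = 0 := by simp [target, hf, hi0]
      simp only [ht]
      constructor
      · rintro ⟨h, h'⟩
        exfalso
        have h1 := h'.resolve_left hi0
        -- Split `w[j+1:n]` into `r₁`, which contains `a`, and `r₂`, which contains `u`. If `r₁`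
        -- ends within the factor, `a` occurs in the factor; otherwise the part of `r₁` beyond it
        -- supplies `a`, and all of `a :: u` embeds after `i`. Both are impossible.
        rw [drop_eq_factor_append hji.le hi, List.cons_sublist_iff] at h1
        obtain ⟨r₁, r₂, h2, h3, h4⟩ := h1
        have hnf : a ∉ factor w j i := fun h => hf ((mem_factor_iff hji hi).1 h)
        have h5 : List.Sublist (a :: u) (w.drop i) := by
          obtain ⟨t, rfl | h6⟩ : ∃ t, r₁ = factor w j i ++ t ∨ factor w j i = r₁ ++ t := by
            rcases List.append_eq_append_iff.1 h2 with ⟨t, h, -⟩ | ⟨t, h, -⟩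
            · exact ⟨t, Or.inl h⟩
            · exact ⟨t, Or.inr h⟩
          · rw [List.append_assoc] at h2
            rw [List.append_cancel_left h2]
            exact (List.singleton_sublist.2 ((List.mem_append.1 h3).resolve_left hnf)).append h4
          · exact absurd (by rw [h6]; exact List.mem_append_left _ h3) hnf
        rw [← isMAS_drop_cons_iff hi] at h
        exact h.1 h5
      · rintro (⟨h, -⟩ | ⟨h, -⟩)
        · omega
        · exact absurd rfl h
  · have ht : target w 0 0 a = nextPos w 0 a := by simp [target]
    rw [ht, Good]
    simp only [true_or, and_true]
    constructor
    · rintro (h | ⟨h1, h2, h3⟩)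
      · exact Or.inl h
      · exact Or.inr ⟨by omega, h1, h2, Or.inr h3⟩
    · rintro (h | ⟨h1, h2, h3, h4⟩)
      · exact Or.inl h
      · exact Or.inr ⟨h2, h3, h4.resolve_left (by omega)⟩

/-- The edges out of the source are the case `i = 0`, in which no occurrence in a factor is
required; so one function `target` covers all four kinds of edges and makes the graph deterministic.
-/
theorem edge_iff {w : List (Fin σ)} {i j : ℕ} (hp : IsPair w.length i j) {a : Fin σ} {y : Node} :
    Edge w (.pos i j) a y ↔
      (target w i j a = w.length + 1 ∧ y = .sink) ∨
      (target w i j a ≠ 0 ∧ target w i j a ≤ w.length ∧ y = .pos (target w i j a) i) := by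
  have hi := hp.le.1
  have hlt := lt_nextPos w i a
  have hle := nextPos_le hi a
  have hmem := mem_drop_iff hi (a := a)
  constructor
  · intro h
    cases h with
    | start _ k h =>
      have ht : target w 0 0 a = nextPos w 0 a := by simp [target]
      obtain ⟨h1, h2⟩ := (isNext_iff hi).1 h
      right; rw [ht, h1]; exact ⟨by omega, h2, rfl⟩
    | step _ _ _ k hji hf h =>
      have ht : target w i j a = nextPos w i a := by simp [target, (mem_factor_iff hji hi).1 hf]
      obtain ⟨h1, h2⟩ := (isNext_iff hi).1 h
      right; rw [ht, h1]; exact ⟨by omega, h2, rfl⟩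
    | final _ _ _ hji _ hf h =>
      have ht : target w i j a = nextPos w i a := by simp [target, (mem_factor_iff hji hi).1 hf]
      rw [factor, List.take_length, hmem] at h
      left; rw [ht]; exact ⟨by omega, rfl⟩
    | absent _ h =>
      have ht : target w 0 0 a = nextPos w 0 a := by simp [target]
      rw [List.drop_zero] at hmem
      rw [hmem] at h
      left; rw [ht]; exact ⟨by omega, rfl⟩
  · intro h
    rcases hp with ⟨hji, _⟩ | ⟨rfl, rfl⟩
    · by_cases hf : nextPos w j a ≤ i
      · have ht : target w i j a = nextPos w i a := by simp [target, hf]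
        rw [ht] at h
        rcases h with ⟨h, rfl⟩ | ⟨h1, h2, rfl⟩
        · refine .final _ _ _ hji hi ((mem_factor_iff hji hi).2 hf) ?_
          rw [factor, List.take_length, hmem]; omega
        · exact .step _ _ _ _ hji ((mem_factor_iff hji hi).2 hf) ((isNext_iff hi).2 ⟨rfl, h2⟩)
      · have ht : target w i j a = 0 := by simp [target, hf]; omega
        rw [ht] at h
        simp at h
    · have ht : target w 0 0 a = nextPos w 0 a := by simp [target]
      rw [ht] at h
      rcases h with ⟨h, rfl⟩ | ⟨h1, h2, rfl⟩
      · refine .absent _ ?_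
        rw [List.drop_zero] at hmem
        rw [hmem]; omega
      · exact .start _ _ ((isNext_iff hi).2 ⟨rfl, h2⟩)

/-- From each node there is an edge. -/
theorem exists_target_ne_zero {w : List (Fin σ)} (hσ : 1 ≤ σ) {i j : ℕ}
    (hp : IsPair w.length i j) : ∃ a, target w i j a ≠ 0 := by
  rcases hp with ⟨hji, hi⟩ | ⟨rfl, rfl⟩
  -- The letter at position `i` belongs to `w[j+1:i]` because `j < i`. At the source every letter
  -- labels an edge.
  · refine ⟨w[i - 1], ?_⟩
    have : nextPos w j w[i - 1] ≤ i := by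
      rw [← mem_factor_iff hji hi]
      refine List.mem_of_getElem? (i := i - 1 - j) ?_
      rw [factor, List.getElem?_drop, List.getElem?_take_of_lt (by omega),
        List.getElem?_eq_getElem (by omega)]
      congr 2; omega
    have := lt_nextPos w i w[i - 1]
    simp only [target]
    rw [if_pos (by omega)]; omega
  · refine ⟨⟨0, by omega⟩, ?_⟩
    simp [target, nextPos]

/-- Each letter but the last moves the first coordinate up by at least one, and it stays at most
`n`. -/
theorem Good.length_le {w u : List (Fin σ)} {i j : ℕ} (hp : IsPair w.length i j)
    (h : Good w i j u) : u.length + i ≤ w.length + 1 := by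
  induction u generalizing i j with
  | nil => exact absurd h not_good_nil
  | cons a u ih =>
    rcases (good_cons_iff hp).1 h with ⟨h1, rfl⟩ | ⟨h1, h2, h3⟩
    · have := hp.le.1; simp; omega
    · have := ih (IsPair.target h1 h2) h3
      have := target_bounds h1
      simp; omega

/-- Following edges never gets stuck and cannot go on forever, so it arrives at the sink. At the
source this yields an MAS, hence one of maximal length. -/
theorem exists_good {w : List (Fin σ)} (hσ : 1 ≤ σ) {i j : ℕ} (hp : IsPair w.length i j) :
    ∃ u, Good w i j u := by
  induction h : w.length - i using Nat.strong_induction_on generalizing i j with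
  | _ m ih =>
    obtain ⟨a, ha⟩ := exists_target_ne_zero hσ hp
    have h1 := target_bounds ha
    have h2 := target_le hp.le.1 j a
    by_cases h3 : target w i j a ≤ w.length
    · obtain ⟨u, hu⟩ := ih _ (by omega) (IsPair.target ha h3) rfl
      exact ⟨a :: u, (good_cons_iff hp).2 (Or.inr ⟨ha, h3, hu⟩)⟩
    · exact ⟨[a], (good_cons_iff hp).2 (Or.inl ⟨by omega, rfl⟩)⟩

/-! ### Paths -/

theorem good_label {w : List (Fin σ)} {i j : ℕ} (hp : IsPair w.length i j)
    {p : List (Fin σ × Node)} (h : IsPath w (.pos i j) p .sink) : Good w i j (label p) := by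
  induction p generalizing i j with
  | nil => exact absurd h (by simp [IsPath])
  | cons x p ih =>
    obtain ⟨a, y⟩ := x
    obtain ⟨he, h⟩ := h
    refine (good_cons_iff hp).2 ?_
    rcases (edge_iff hp).1 he with ⟨h1, rfl⟩ | ⟨h1, h2, rfl⟩
    · left
      refine ⟨h1, ?_⟩
      cases p with
      | nil => rfl
      | cons x p => obtain ⟨he, -⟩ := h; cases he
    · exact Or.inr ⟨h1, h2, ih (IsPair.target h1 h2) h⟩

theorem exists_path {w : List (Fin σ)} {i j : ℕ} (hp : IsPair w.length i j)
    {u : List (Fin σ)} (h : Good w i j u) : ∃ p, IsPath w (.pos i j) p .sink ∧ label p = u := by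
  induction u generalizing i j with
  | nil => exact absurd h not_good_nil
  | cons a u ih =>
    rcases (good_cons_iff hp).1 h with ⟨h1, rfl⟩ | ⟨h1, h2, h3⟩
    · exact ⟨[(a, .sink)], ⟨(edge_iff hp).2 (Or.inl ⟨h1, rfl⟩), rfl⟩, rfl⟩
    · obtain ⟨p, hp', rfl⟩ := ih (IsPair.target h1 h2) h3
      exact ⟨(a, .pos (target w i j a) i) :: p,
        ⟨(edge_iff hp).2 (Or.inr ⟨h1, h2, rfl⟩), hp'⟩, rfl⟩

/-- Node and letter determine the next node, and no edge leaves the sink. -/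
theorem path_unique {w : List (Fin σ)} {i j : ℕ} (hp : IsPair w.length i j)
    {p q : List (Fin σ × Node)} (h : IsPath w (.pos i j) p .sink)
    (h' : IsPath w (.pos i j) q .sink) (hl : label p = label q) : p = q := by
  induction p generalizing i j q with
  | nil => exact absurd h (by simp [IsPath])
  | cons x p ih =>
    obtain ⟨a, y⟩ := x
    cases q with
    | nil => exact absurd h' (by simp [IsPath])
    | cons x q =>
      obtain ⟨b, z⟩ := x
      obtain ⟨he, h⟩ := h
      obtain ⟨he', h'⟩ := h'
      simp only [label, List.map_cons, List.cons.injEq] at hl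
      obtain ⟨rfl, hl⟩ := hl
      rcases (edge_iff hp).1 he with ⟨h1, rfl⟩ | ⟨h1, h2, rfl⟩ <;>
        rcases (edge_iff hp).1 he' with ⟨h3, rfl⟩ | ⟨h3, h4, rfl⟩
      · cases p with
        | cons x p => obtain ⟨he, -⟩ := h; cases he
        | nil =>
          cases q with
          | cons x q => obtain ⟨he, -⟩ := h'; cases he
          | nil => rfl
      · omega
      · omega
      · rw [ih (IsPair.target h1 h2) h h' hl]

theorem bijOn_label (w : List (Fin σ)) :
    Set.BijOn label {p | IsPath w (.pos 0 0) p .sink} {v | IsMAS w v} := by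
  have hp : IsPair w.length 0 0 := Or.inr ⟨rfl, rfl⟩
  refine ⟨fun p h => good_zero.1 (good_label hp h), fun p h q h' hl => path_unique hp h h' hl,
    fun u hu => ?_⟩
  obtain ⟨p, h1, h2⟩ := exists_path hp (good_zero.2 hu)
  exact ⟨p, h1, h2⟩

/-- The first component of a node; the sink counts as `n + 1`. -/
def height (n : ℕ) : Node → ℕ
  | .pos i _ => i
  | .sink => n + 1

theorem Edge.height_lt {w : List (Fin σ)} {x y : Node} {a : Fin σ} (h : Edge w x a y) :
    height w.length x < height w.length y := by
  cases h with
  | start _ i h => exact h.1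
  | step i j _ k _ _ h => exact h.1
  | final i j b _ h => simp only [height]; omega
  | absent _ => simp [height]

theorem IsPath.height_le {w : List (Fin σ)} {x y : Node} {p : List (Fin σ × Node)}
    (h : IsPath w x p y) : height w.length x + p.length ≤ height w.length y := by
  induction p generalizing x with
  | nil => simp only [IsPath] at h; subst h; simp
  | cons e p ih =>
    have h1 := h.1.height_lt
    have h2 := ih h.2
    simp only [List.length_cons]; omega

theorem isAcyclic (w : List (Fin σ)) : IsAcyclic w := by
  intro x p h
  have := h.height_le
  exact List.eq_nil_of_length_eq_zero (by omega)

end Words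

/-! ### Total correctness of programs -/

/-- The value of an expression when overflow is ignored. -/
def Expr.val (s : State) : Expr → ℕ
  | .const c => c
  | .reg x => s.reg x
  | .read A e => s.arr A (e.val s)
  | .op o e₁ e₂ => o.apply (e₁.val s) (e₂.val s)

/-- No overflow occurs in the evaluation of an expression. -/
def Expr.Fits (W : ℕ) (s : State) : Expr → Prop
  | .const c => c < W
  | .reg x => s.reg x < W
  | .read A e => e.Fits W s ∧ s.arr A (e.val s) < W
  | .op o e₁ e₂ => e₁.Fits W s ∧ e₂.Fits W s ∧ o.apply (e₁.val s) (e₂.val s) < W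

/-- Separates the check for overflow from the computation of the value, so that each becomes an
arithmetic goal of its own. -/
theorem Expr.Fits.eval {W : ℕ} {s : State} {e : Expr} (h : e.Fits W s) :
    e.eval W s = some (e.val s) := by
  induction e with
  | const c => simp only [Expr.Fits] at h; simp [Expr.eval, Expr.val, word, h]
  | reg x => simp only [Expr.Fits] at h; simp [Expr.eval, Expr.val, word, h]
  | read A e ih => simp [Expr.eval, Expr.val, word, ih h.1, h.2]
  | op o e₁ e₂ ih₁ ih₂ => simp [Expr.eval, Expr.val, word, ih₁ h.1, ih₂ h.2.1, h.2.2]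

/-- The program `c` started in `s` halts without overflow in a state that satisfies `Q`. -/
def Ends (W : ℕ) (c : Cmd) (s : State) (Q : State → Prop) : Prop :=
  ∃ s', Exec W c s s' ∧ Q s'

section Rules

variable {W : ℕ} {s : State} {Q : State → Prop}

theorem Ends.mono {c : Cmd} {P : State → Prop} (h : Ends W c s P) (hPQ : ∀ s', P s' → Q s') :
    Ends W c s Q := by
  obtain ⟨s', h1, h2⟩ := h
  exact ⟨s', h1, hPQ s' h2⟩

theorem Ends.skip (h : Q (s.tick 1)) : Ends W .skip s Q := ⟨_, .skip s, h⟩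

theorem Ends.assign {x : ℕ} {e : Expr} (he : e.Fits W s)
    (h : Q { s with reg := Function.update s.reg x (e.val s), clock := s.clock + (e.cost + 1) }) :
    Ends W (.assign x e) s Q := ⟨_, .assign s x e _ he.eval, h⟩

theorem Ends.store {A : Arr} {i e : Expr} (hi : i.Fits W s) (he : e.Fits W s)
    (h : Q { s with
      arr := Function.update s.arr A (Function.update (s.arr A) (i.val s) (e.val s))
      clock := s.clock + (i.cost + e.cost + 1) }) :
    Ends W (.store A i e) s Q := ⟨_, .store s A i e _ _ hi.eval he.eval, h⟩

theorem Ends.output {e : Expr} (he : e.Fits W s)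
    (h : Q { s with
      clock := s.clock + (e.cost + 1)
      out := s.out ++ [(s.clock + (e.cost + 1), e.val s)] }) :
    Ends W (.output e) s Q := ⟨_, .output s e _ he.eval, h⟩

theorem Ends.seq {c₁ c₂ : Cmd} (h : Ends W c₁ s fun s' => Ends W c₂ s' Q) :
    Ends W (.seq c₁ c₂) s Q := by
  obtain ⟨s', h1, s'', h2, h3⟩ := h
  exact ⟨s'', .seq _ _ _ _ _ h1 h2, h3⟩

theorem Ends.cond {e : Expr} {c₁ c₂ : Cmd} (he : e.Fits W s)
    (h₁ : e.val s ≠ 0 → Ends W c₁ (s.tick (e.cost + 1)) Q)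
    (h₂ : e.val s = 0 → Ends W c₂ (s.tick (e.cost + 1)) Q) :
    Ends W (.cond e c₁ c₂) s Q := by
  by_cases h : e.val s = 0
  · obtain ⟨s', h1, h2⟩ := h₂ h
    exact ⟨s', .cond_false _ _ _ _ _ (by rw [he.eval, h]) h1, h2⟩
  · obtain ⟨s', h1, h2⟩ := h₁ h
    exact ⟨s', .cond_true _ _ _ _ _ _ he.eval h h1, h2⟩

end Rules

infixl:65 "+ₑ" => Expr.op Op.add
infixl:65 "-ₑ" => Expr.op Op.sub
infixl:70 "*ₑ" => Expr.op Op.mul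
infixl:70 "/ₑ" => Expr.op Op.div
infixl:70 "%ₑ" => Expr.op Op.mod
infix:50 "<ₑ" => Expr.op Op.lt
infix:50 "=ₑ" => Expr.op Op.eq
infixr:30 ";;" => Cmd.seq

/-- Run `c` with register `x` equal to `0, 1, …` below the value of register `b`. -/
def forLoop (x b : ℕ) (c : Cmd) : Cmd :=
  .assign x (.const 0) ;; .loop (.reg x <ₑ .reg b) (c ;; .assign x (.reg x +ₑ .const 1))

/-- Invariants for `forLoop`, with a bound for the running time. -/
theorem Ends.forLoop {W : ℕ} {s : State} {Q : State → Prop} {x b : ℕ} {c : Cmd}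
    (I : ℕ → State → Prop) (N T : ℕ) (hb : s.reg b = N) (hxb : b ≠ x) (hN : N < W) (hW : 1 < W)
    (clock : ∀ t s k, I t s → I t { s with clock := k })
    (base : ∀ k, I 0 { s with reg := Function.update s.reg x 0, clock := k })
    (step : ∀ t s, t < N → s.reg x = t → s.reg b = N → I t s → Ends W c s fun s' =>
      s'.reg x = t ∧ s'.reg b = N ∧ s'.clock ≤ s.clock + T ∧
        I (t + 1) { s' with reg := Function.update s'.reg x (t + 1) })
    (post : ∀ s', I N s' → s'.clock ≤ s.clock + (N * (T + 8) + 6) → Q s') :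
    Ends W (forLoop x b c) s Q := by
  -- Induction on the number `m` of remaining rounds. A test and an increment cost `4` each, so a
  -- round costs `T + 8`; the last, failing test costs `4`, and the initial assignment `2` more.
  have main : ∀ m t s, t + m = N → s.reg x = t → s.reg b = N → I t s →
      Ends W (.loop (.reg x <ₑ .reg b) (c ;; .assign x (.reg x +ₑ .const 1))) s fun s' =>
        I N s' ∧ s'.clock ≤ s.clock + (m * (T + 8) + 4) := by
    intro m
    induction m with
    | zero =>
      intro t s ht hx hb hI
      refine ⟨_, .loop_false _ _ _ ?_, ?_⟩
      · rw [Expr.Fits.eval]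
        · simp [Expr.val, Op.apply, hx, hb]; omega
        · simp only [Expr.Fits, Expr.val, Op.apply, hx, hb]
          refine ⟨by omega, by omega, ?_⟩
          split_ifs <;> omega
      · obtain rfl : t = N := by omega
        exact ⟨clock _ _ _ hI, by simp [State.tick, Expr.cost]⟩
    | succ m ih =>
      intro t s ht hx hb hI
      obtain ⟨s', h1, h2, h3, h4, h5⟩ := step t (s.tick 4) (by omega) hx hb (clock _ _ _ hI)
      obtain ⟨s'', h6, h7, h8⟩ := ih (t + 1)
        { s' with reg := Function.update s'.reg x (t + 1), clock := s'.clock + 4 } (by omega)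
        (by simp) (by simp [hxb, h3]) (clock _ _ _ h5)
      refine ⟨s'', .loop_true _ _ s _ s'' 1 ?_ (by simp) (.seq _ _ _ _ _ h1 ?_) h6, h7, ?_⟩
      · rw [Expr.Fits.eval]
        · simp [Expr.val, Op.apply, hx, hb]; omega
        · simp only [Expr.Fits, Expr.val, Op.apply, hx, hb]
          refine ⟨by omega, by omega, ?_⟩
          split_ifs <;> omega
      · have he : Expr.eval W s' (.reg x +ₑ .const 1) = some (t + 1) := by
          rw [Expr.Fits.eval]
          · simp [Expr.val, Op.apply, h2]
          · simp only [Expr.Fits, Expr.val, Op.apply, h2]; omega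
        exact .assign s' x _ _ he
      · simp only [State.tick] at h4 h8 ⊢
        rw [Nat.succ_mul]; omega
  refine Ends.seq (Ends.assign (by simp only [Expr.Fits]; omega) ?_)
  refine (main N 0 _ (by omega) ?_ ?_ (base _)).mono fun s' h => post s' h.1 ?_
  · simp
  · simp [hxb, hb]
  · have := h.2
    simp only [Expr.cost] at this
    omega

/-! ### Access to the input -/

section Input

variable {σ : ℕ}

@[simp] theorem inputArray_zero (w : List (Fin σ)) : inputArray w 0 = w.length := rfl

@[simp] theorem inputArray_one (w : List (Fin σ)) : inputArray w 1 = σ := rfl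

theorem code_eq_map (v : List (Fin σ)) : code v = v.map fun a : Fin σ => a.val + 1 := by
  induction v with
  | nil => rfl
  | cons a v ih =>
    rw [List.map_cons, ← ih]
    simp [code]

theorem load_code {u : List (Fin σ)} (m i : ℕ) (hi : i < u.length) :
    load (m :: code u) (i + 1) = (u[i] : Fin σ).val + 1 := by
  simp [load, code_eq_map, List.getD, hi]

theorem inputArray_add_two (w : List (Fin σ)) (i : ℕ) (hi : i < w.length) :
    inputArray w (i + 2) = (w[i] : Fin σ).val + 1 := by
  simp [inputArray, load, code_eq_map, List.getD, hi]

/-- Registers `0`, `1`, `2` hold `n`, `σ` and `n + 1`; the input is intact, and the arrays `data`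
have the contents `D`. -/
structure Env (w : List (Fin σ)) (D : ℕ → ℕ → ℕ) (s : State) : Prop where
  length : s.reg 0 = w.length
  size : s.reg 1 = σ
  succ : s.reg 2 = w.length + 1
  input : s.arr .input = inputArray w
  data : ∀ k, s.arr (.data k) = D k

def setup : Cmd :=
  .assign 0 (.read .input (.const 0)) ;; .assign 1 (.read .input (.const 1)) ;;
    .assign 2 (.reg 0 +ₑ .const 1)

theorem Ends.setup {W : ℕ} {w : List (Fin σ)} {s : State} {Q : State → Prop}
    (hσ : σ ≤ w.length) (hW : w.length + 1 < W) (hin : s.arr .input = inputArray w)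
    (h : ∀ s', Env w (fun k => s.arr (.data k)) s' → s'.arr = s.arr → s'.out = s.out →
      s'.clock = s.clock + 10 → Q s') : Ends W setup s Q := by
  refine Ends.seq (Ends.assign ?_ (Ends.seq (Ends.assign ?_ (Ends.assign ?_ (h _ ?_ rfl rfl ?_)))))
  · simp [Expr.Fits, Expr.val, hin]; omega
  · simp [Expr.Fits, Expr.val, hin]; omega
  · simp [Expr.Fits, Expr.val, hin, Op.apply]; omega
  · constructor <;> simp [Expr.val, hin, Op.apply]
  · simp [Expr.cost]

end Input

/-! ### Construction of the graph -/

section Build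

variable {σ : ℕ}

/-- `A` is the table of the edges of the graph of `w`. -/
def IsTable (w : List (Fin σ)) (A : ℕ → ℕ) : Prop :=
  ∀ i j, i ≤ w.length → j ≤ w.length → ∀ a : Fin σ,
    A ((i * (w.length + 1) + j) * σ + a) = target w i j a

/-- The table is filled for all `i, j ≤ n`; entries for pairs that are not nodes carry no meaning
for the graph. -/
theorem IsTable.storesGraph {w : List (Fin σ)} {A : ℕ → ℕ} (h : IsTable w A) :
    StoresGraph w A := by
  intro i j a hp
  rw [h i j hp.le.1 hp.le.2 a]
  refine ⟨target_le hp.le.1 j a, fun k h1 h2 => ?_, ?_⟩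
  · rw [edge_iff hp]
    simp only [reduceCtorEq, and_false, false_or, Node.pos.injEq, and_true]
    constructor
    · rintro rfl; exact ⟨by omega, h2, rfl⟩
    · rintro ⟨-, -, h⟩; exact h.symm
  · rw [edge_iff hp]; simp

/-- Mixed radix notation: this bounds the index of a cell in a multidimensional table, and the next
two lemmas recover its coordinates. -/
theorem mul_add_lt {i m a s : ℕ} (hi : i < m) (ha : a < s) : i * s + a < m * s := by
  have := Nat.mul_le_mul_right s hi
  rw [Nat.succ_mul] at this; omega

theorem mul_add_div_eq {i a s : ℕ} (ha : a < s) : (i * s + a) / s = i := by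
  rw [Nat.mul_comm, Nat.mul_add_div (by omega), Nat.div_eq_of_lt ha, Nat.add_zero]

theorem mul_add_mod_eq {i a s : ℕ} (ha : a < s) : (i * s + a) % s = a := by
  rw [Nat.mul_comm, Nat.mul_add_mod, Nat.mod_eq_of_lt ha]

/-- Cell `(n - i) * σ + a` of the array `data 1` gets the first position after `i` with letter
`a`. -/
def fillNext : Cmd :=
  .assign 3 (.reg 2 *ₑ .reg 1) ;;
  forLoop 4 3
    (.cond (.reg 4 <ₑ .reg 1) (.store (.data 1) (.reg 4) (.reg 2))
      (.assign 6 (.reg 0 -ₑ .reg 4 /ₑ .reg 1) ;;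
        .cond (.read .input (.reg 6 +ₑ .const 2) =ₑ .reg 4 %ₑ .reg 1 +ₑ .const 1)
          (.store (.data 1) (.reg 4) (.reg 6 +ₑ .const 1))
          (.store (.data 1) (.reg 4) (.read (.data 1) (.reg 4 -ₑ .reg 1)))))

/-- The rows are ordered by `n - i`, from the empty suffix on, so the row of `i + 1` is available
when that of `i` is filled by `nextPos_eq_ite`. -/
theorem Ends.fillNext {W : ℕ} {w : List (Fin σ)} {D : ℕ → ℕ → ℕ} {s : State} {Q : State → Prop}
    (hσ₁ : 1 ≤ σ) (hσ : σ ≤ w.length) (hW : (w.length + 1) ^ 3 + 10 < W) (henv : Env w D s)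
    (h : ∀ s', Env w (fun k => s'.arr (.data k)) s' →
      (∀ i ≤ w.length, ∀ a : Fin σ,
        s'.arr (.data 1) ((w.length - i) * σ + a) = nextPos w i a) →
      s'.clock ≤ s.clock + ((w.length + 1) * σ * 38 + 10) → Q s') : Ends W fillNext s Q := by
  obtain ⟨h0, h1, h2, hin, hD⟩ := henv
  have hW1 : (w.length + 1) * σ < W := by
    nlinarith [Nat.mul_le_mul_left (w.length + 1) hσ, Nat.zero_le (w.length ^ 3)]
  have hn1 : w.length + 1 ≤ (w.length + 1) * σ := Nat.le_mul_of_pos_right _ hσ₁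
  have hsn : σ ≤ (w.length + 1) * σ := Nat.le_mul_of_pos_left _ (by omega)
  refine Ends.seq (Ends.assign ?_ ?_)
  · simp only [Expr.Fits, Expr.val, Op.apply, h1, h2]; omega
  refine Ends.forLoop
    (fun t s => s.reg 0 = w.length ∧ s.reg 1 = σ ∧ s.reg 2 = w.length + 1 ∧
      s.arr .input = inputArray w ∧
      ∀ i ≤ w.length, ∀ a : Fin σ, (w.length - i) * σ + a < t →
        s.arr (.data 1) ((w.length - i) * σ + a) = nextPos w i a)
    ((w.length + 1) * σ) 30 ?_ (by simp) hW1 (by omega) (fun _ _ _ h => h) ?_ ?_ ?_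
  · simp [Expr.val, Op.apply, h1, h2]
  · simp [h0, h1, h2, hin]
  · rintro t s ht hx hb ⟨h0, h1, h2, hin, hT⟩
    have htm : t % σ < σ := Nat.mod_lt _ hσ₁
    have htd : t / σ < w.length + 1 := (Nat.div_lt_iff_lt_mul hσ₁).2 ht
    have hdm := Nat.div_add_mod' t σ
    have hstep : ∀ v : ℕ, (∀ i ≤ w.length, ∀ a : Fin σ, (w.length - i) * σ + a = t →
        v = nextPos w i a) →
        ∀ i ≤ w.length, ∀ a : Fin σ, (w.length - i) * σ + a ≤ t →
        Function.update (s.arr (.data 1)) t v ((w.length - i) * σ + a) = nextPos w i a := by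
      intro v hv i hi a hia
      by_cases hit : (w.length - i) * σ + a = t
      · rw [hit, Function.update_self]; exact hv i hi a hit
      · rw [Function.update_of_ne hit]; exact hT i hi a (by omega)
    refine Ends.cond ?_ (fun hc => ?_) (fun hc => ?_)
    · simp only [Expr.Fits, Expr.val, Op.apply, h1, hx]
      split_ifs <;> omega
    · simp only [Expr.val, Op.apply, h1, hx] at hc
      have hc : t < σ := by by_contra h; simp [h] at hc
      refine Ends.store ?_ ?_ ?_
      · simp only [Expr.Fits, State.tick, hx]; omega
      · simp only [Expr.Fits, State.tick, h2]; omega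
      · simp only [State.tick, Expr.val, Expr.cost, hx, h2]
        refine ⟨by simp, hb, by omega, by simpa, by simpa, by simpa, by simpa, ?_⟩
        simp only [Function.update_self, Nat.lt_succ_iff]
        refine hstep _ fun i hi a hia => ?_
        have : (w.length - i) = 0 := by
          have := mul_add_div_eq (i := w.length - i) a.2
          rw [hia, Nat.div_eq_of_lt hc] at this; exact this.symm
        obtain rfl : i = w.length := by omega
        rw [nextPos_length]
    · simp only [Expr.val, Op.apply, h1, hx] at hc
      have hc : σ ≤ t := by by_contra h; simp [Nat.lt_of_not_le h] at hc
      have htd' : 1 ≤ t / σ := (Nat.one_le_div_iff hσ₁).2 hc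
      have hia' : ∀ i ≤ w.length, ∀ a : Fin σ, (w.length - i) * σ + a = t →
          i = w.length - t / σ ∧ a.val = t % σ := by
        intro i hi a hia
        have e1 := mul_add_div_eq (i := w.length - i) a.2
        have e2 := mul_add_mod_eq (i := w.length - i) a.2
        rw [hia] at e1 e2; omega
      have hid : w.length - t / σ < w.length := by omega
      have hinput := inputArray_add_two w (w.length - t / σ) hid
      have hlt := (w[w.length - t / σ]'hid).2
      refine Ends.seq (Ends.assign ?_ (Ends.cond ?_ (fun hc' => ?_) (fun hc' => ?_)))
      · simp only [Expr.Fits, Expr.val, Op.apply, State.tick, h0, h1, hx]; omega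
      · simp [Expr.Fits, Expr.val, Op.apply, State.tick, h0, h1, hx, hin, hinput]
        split_ifs <;> omega
      · simp [Expr.val, Op.apply, State.tick, h0, h1, hx, hin, hinput] at hc'
        refine Ends.store ?_ ?_ ?_
        · simp [Expr.Fits, State.tick, hx]; omega
        · simp [Expr.Fits, Expr.val, Op.apply, State.tick, h0, h1, hx]; omega
        · simp only [State.tick, Expr.val, Expr.cost, Op.apply, hx, h0, h1]
          refine ⟨by simp [hx], by simp [hb], by omega, by simpa, by simpa, by simpa, by simpa, ?_⟩
          simp [hx]
          refine hstep _ fun i hi a hia => ?_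
          obtain ⟨rfl, ha⟩ := hia' i hi a hia
          rw [nextPos_eq_ite hid, if_pos]
          exact Fin.ext (by omega)
      · simp [Expr.val, Op.apply, State.tick, h0, h1, hx, hin, hinput] at hc'
        -- One row back, hence `σ` cells back, is the entry for the same letter and the position `i
        -- + 1`.
        have hprev : s.arr (.data 1) (t - σ) =
            nextPos w (w.length - t / σ + 1) ⟨t % σ, htm⟩ := by
          have e : (w.length - (w.length - t / σ + 1)) * σ + t % σ = t - σ := by
            have e1 : w.length - (w.length - t / σ + 1) = t / σ - 1 := by omega
            have := Nat.le_mul_of_pos_left σ htd'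
            rw [e1, Nat.sub_mul]; omega
          rw [← hT (w.length - t / σ + 1) (by omega) ⟨t % σ, htm⟩ (by simp only [e]; omega)]
          simp only [e]
        have hle := nextPos_le (w := w) (i := w.length - t / σ + 1) (by omega) ⟨t % σ, htm⟩
        refine Ends.store ?_ ?_ ?_
        · simp [Expr.Fits, State.tick, hx]; omega
        · simp [Expr.Fits, Expr.val, Op.apply, State.tick, h1, hx, hprev]; omega
        · simp only [State.tick, Expr.val, Expr.cost, Op.apply, hx, h0, h1]
          refine ⟨by simp [hx], by simp [hb], by omega, by simpa, by simpa, by simpa, by simpa, ?_⟩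
          simp [hx, h1, hprev]
          refine hstep _ fun i hi a hia => ?_
          obtain ⟨rfl, ha⟩ := hia' i hi a hia
          obtain rfl : a = ⟨t % σ, htm⟩ := Fin.ext ha
          rw [nextPos_eq_ite hid, if_neg]
          exact fun h => hc' (by rw [h])
  · rintro s' ⟨h0, h1, h2, hin, hT⟩ hclock
    refine h s' ⟨h0, h1, h2, hin, fun _ => rfl⟩ (fun i hi a => hT i hi a ?_) ?_
    · exact mul_add_lt (by omega) a.2
    · simp only [Expr.cost] at hclock; omega

/-- The table of edges, in the array `data 0`. -/
def fillTable : Cmd :=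
  .assign 3 (.reg 2 *ₑ .reg 2 *ₑ .reg 1) ;;
  forLoop 4 3
    (.assign 5 (.reg 4 %ₑ .reg 1) ;;
      .assign 6 (.reg 4 /ₑ .reg 1 /ₑ .reg 2) ;;
      .assign 7 (.reg 4 /ₑ .reg 1 %ₑ .reg 2) ;;
      .cond ((.read (.data 1) ((.reg 0 -ₑ .reg 7) *ₑ .reg 1 +ₑ .reg 5) <ₑ .reg 6 +ₑ .const 1) +ₑ
          (.reg 6 =ₑ .const 0))
        (.store (.data 0) (.reg 4) (.read (.data 1) ((.reg 0 -ₑ .reg 6) *ₑ .reg 1 +ₑ .reg 5)))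
        (.store (.data 0) (.reg 4) (.const 0)))

/-- Two lookups of next positions decide an entry in constant time. The sum of the two truth values
in the test plays the role of a disjunction. -/
theorem Ends.fillTable {W : ℕ} {w : List (Fin σ)} {D : ℕ → ℕ → ℕ} {s : State} {Q : State → Prop}
    (hσ₁ : 1 ≤ σ) (hσ : σ ≤ w.length) (hW : (w.length + 1) ^ 3 + 10 < W) (henv : Env w D s)
    (hnext : ∀ i ≤ w.length, ∀ a : Fin σ,
      s.arr (.data 1) ((w.length - i) * σ + a) = nextPos w i a)
    (h : ∀ s', s'.arr .input = inputArray w → IsTable w (s'.arr (.data 0)) →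
      s'.clock ≤ s.clock + ((w.length + 1) * (w.length + 1) * σ * 58 + 20) → Q s') :
    Ends W fillTable s Q := by
  obtain ⟨h0, h1, h2, hin, -⟩ := henv
  set n := w.length with hn
  have hW2 : (n + 1) * (n + 1) * σ < W := by
    nlinarith [Nat.mul_le_mul_left ((n + 1) * (n + 1)) hσ, Nat.zero_le (n ^ 3)]
  have hnn : n + 1 ≤ (n + 1) * (n + 1) := Nat.le_mul_of_pos_left _ (by omega)
  have hle : (n + 1) * (n + 1) ≤ (n + 1) * (n + 1) * σ := Nat.le_mul_of_pos_right _ hσ₁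
  have hsn : (n + 1) * σ ≤ (n + 1) * (n + 1) * σ := Nat.mul_le_mul_right _ hnn
  refine Ends.seq (Ends.assign ?_ ?_)
  · simp only [Expr.Fits, Expr.val, Op.apply, h1, h2]; omega
  refine Ends.forLoop
    (fun t s => s.reg 0 = n ∧ s.reg 1 = σ ∧ s.reg 2 = n + 1 ∧ s.arr .input = inputArray w ∧
      (∀ i ≤ n, ∀ a : Fin σ, s.arr (.data 1) ((n - i) * σ + a) = nextPos w i a) ∧
      ∀ i j, i ≤ n → j ≤ n → ∀ a : Fin σ, (i * (n + 1) + j) * σ + a < t →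
        s.arr (.data 0) ((i * (n + 1) + j) * σ + a) = target w i j a)
    ((n + 1) * (n + 1) * σ) 50 ?_ (by simp) hW2 (by omega) (fun _ _ _ h => h) ?_ ?_ ?_
  · simp [Expr.val, Op.apply, h1, h2]
  · simpa [h0, h1, h2, hin] using hnext
  · rintro t s ht hx hb ⟨h0, h1, h2, hin, hnext, hT⟩
    have ha : t % σ < σ := Nat.mod_lt _ hσ₁
    have htd : t / σ < (n + 1) * (n + 1) := (Nat.div_lt_iff_lt_mul hσ₁).2 ht
    have hi : t / σ / (n + 1) < n + 1 := (Nat.div_lt_iff_lt_mul (by omega)).2 htd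
    have hj : t / σ % (n + 1) < n + 1 := Nat.mod_lt _ (by omega)
    have hsplit : t = (t / σ / (n + 1) * (n + 1) + t / σ % (n + 1)) * σ + t % σ := by
      rw [Nat.div_add_mod', Nat.div_add_mod']
    have hdec : ∀ i j, i ≤ n → j ≤ n → ∀ a : Fin σ, (i * (n + 1) + j) * σ + a = t →
        i = t / σ / (n + 1) ∧ j = t / σ % (n + 1) ∧ a.val = t % σ := by
      intro i j hi hj a h
      have e1 := mul_add_div_eq (i := i * (n + 1) + j) a.2
      have e2 := mul_add_mod_eq (i := i * (n + 1) + j) a.2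
      rw [h] at e1 e2
      rw [e1, e2, mul_add_div_eq (by omega), mul_add_mod_eq (by omega)]
      exact ⟨rfl, rfl, rfl⟩
    have hd1 : t / σ ≤ t := Nat.div_le_self _ _
    generalize hep : t / σ = p at *
    generalize hei : p / (n + 1) = i at *
    generalize hej : p % (n + 1) = j at *
    generalize hea : t % σ = a at *
    have hjx := hnext j (by omega) ⟨a, ha⟩
    have hix := hnext i (by omega) ⟨a, ha⟩
    have hjl := nextPos_le (w := w) (i := j) (by omega) ⟨a, ha⟩
    have hil := nextPos_le (w := w) (i := i) (by omega) ⟨a, ha⟩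
    simp only at hjx hix
    have hji : (n - j) * σ + a < (n + 1) * σ := mul_add_lt (by omega) ha
    have hii : (n - i) * σ + a < (n + 1) * σ := mul_add_lt (by omega) ha
    have hstep : ∀ v : ℕ, v = target w i j ⟨a, ha⟩ →
        ∀ i j, i ≤ n → j ≤ n → ∀ a : Fin σ, (i * (n + 1) + j) * σ + a ≤ t →
        Function.update (s.arr (.data 0)) t v ((i * (n + 1) + j) * σ + a) = target w i j a := by
      intro v hv i' j' hi' hj' a' hia
      by_cases hit : (i' * (n + 1) + j') * σ + a' = t
      · obtain ⟨rfl, rfl, h⟩ := hdec i' j' hi' hj' a' hit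
        obtain rfl : a' = ⟨a, ha⟩ := Fin.ext h
        rw [hit, Function.update_self, hv]
      · rw [Function.update_of_ne hit]; exact hT i' j' hi' hj' a' (by omega)
    refine Ends.seq (Ends.assign ?_ (Ends.seq (Ends.assign ?_ (Ends.seq (Ends.assign ?_
      (Ends.cond ?_ (fun hc => Ends.store ?_ ?_ ?_) (fun hc => Ends.store ?_ ?_ ?_)))))))
    · simp [Expr.Fits, Expr.val, Op.apply, h1, hx, hea]; omega
    · simp [Expr.Fits, Expr.val, Op.apply, h1, h2, hx, hep, hei]; omega
    · simp [Expr.Fits, Expr.val, Op.apply, h1, h2, hx, hep, hej]; omega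
    · simp [Expr.Fits, Expr.val, Op.apply, h0, h1, h2, hx, hep, hei, hej, hea, hjx]
      split_ifs <;> omega
    · simp [Expr.Fits, State.tick, hx]; omega
    · simp [Expr.Fits, Expr.val, Op.apply, State.tick, h0, h1, h2, hx, hep, hei, hea, hix]; omega
    · simp [Expr.val, Op.apply, h0, h1, h2, hx, hep, hei, hej, hea, hjx] at hc
      simp [Expr.val, Expr.cost, Op.apply, State.tick, h0, h1, h2, hx, hb, hin, hep, hei, hea, hix]
      refine ⟨hnext, hstep _ ?_⟩
      rw [target, if_pos]; omega
    · simp [Expr.Fits, State.tick, hx]; omega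
    · simp [Expr.Fits]; omega
    · simp [Expr.val, Op.apply, h0, h1, h2, hx, hep, hei, hej, hea, hjx] at hc
      simp [Expr.val, Expr.cost, Op.apply, State.tick, h0, h1, h2, hx, hb, hin]
      refine ⟨hnext, hstep _ ?_⟩
      rw [target, if_neg]; omega
  · rintro s' ⟨h0, h1, h2, hin, -, hT⟩ hclock
    refine h s' hin (fun i j hi hj a => hT i j hi hj a ?_) ?_
    · exact mul_add_lt (mul_add_lt (by omega) (by omega)) a.2
    · simp only [Expr.cost] at hclock; omega

def buildCmd : Cmd := setup ;; fillNext ;; fillTable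

theorem exists_exec_buildCmd {W : ℕ} {w : List (Fin σ)} (hσ₁ : 1 ≤ σ) (hσ : σ ≤ w.length)
    (hW : (w.length + 1) ^ 3 + 10 < W) :
    ∃ s₁, Exec W buildCmd (initial w) s₁ ∧ s₁.clock ≤ 400 * (w.length ^ 2 * σ) ∧
      s₁.arr .input = inputArray w ∧ IsTable w (s₁.arr (.data 0)) := by
  have hW' : w.length + 1 < W := by nlinarith [Nat.zero_le (w.length ^ 3)]
  refine Ends.seq (Ends.setup hσ hW' (by simp [initial]) fun s henv _ _ hc =>
    Ends.seq (Ends.fillNext hσ₁ hσ hW henv fun s' henv' hnext hc' =>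
      Ends.fillTable hσ₁ hσ hW henv' hnext fun s'' hin hT hc'' => ⟨?_, hin, hT⟩))
  have h0 : (initial w).clock = 0 := rfl
  -- As `1 ≤ n`, the factors `n + 1` can be absorbed into `n ^ 2`; the total is at most `58 * 4 + 38
  -- * 2 + 40` times `n ^ 2 * σ`.
  have h1 : (w.length + 1) * (w.length + 1) * σ ≤ 4 * (w.length ^ 2 * σ) := by
    rw [← mul_assoc]
    exact Nat.mul_le_mul_right _ (by nlinarith)
  have h2 : (w.length + 1) * σ ≤ 2 * (w.length ^ 2 * σ) := by
    rw [← mul_assoc]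
    exact Nat.mul_le_mul_right _ (by nlinarith)
  have h3 : 1 ≤ w.length ^ 2 * σ := Nat.mul_pos (Nat.pow_pos (by omega)) hσ₁
  omega

end Build

/-! ### Testing whether a word is a minimal absent subsequence -/

section Check

variable {σ : ℕ}

theorem index_lt {n i j a : ℕ} (hi : i ≤ n) (hj : j ≤ n) (ha : a < σ) :
    (i * (n + 1) + j) * σ + a < (n + 1) * (n + 1) * σ :=
  mul_add_lt (mul_add_lt (by omega) (by omega)) ha

theorem table_size_le {n : ℕ} (hσ : σ ≤ n) : (n + 1) * (n + 1) * σ ≤ (n + 1) ^ 3 := by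
  rw [pow_succ, pow_two]
  exact Nat.mul_le_mul_left _ (by omega)

/-- Follow the path whose label is the query. Registers `5` and `6` hold the current node; the
sink and the failure state are represented by `n + 1` and `n + 2` in register `5`. -/
def checkCmd : Cmd :=
  setup ;; .assign 3 (.read .query (.const 0)) ;; .assign 5 (.const 0) ;; .assign 6 (.const 0) ;;
  forLoop 4 3
    (.cond (.reg 5 <ₑ .reg 2)
      (.assign 7 (.read (.data 0) ((.reg 5 *ₑ .reg 2 +ₑ .reg 6) *ₑ .reg 1 +ₑ
          (.read .query (.reg 4 +ₑ .const 1) -ₑ .const 1))) ;;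
        .cond (.reg 7) (.assign 6 (.reg 5) ;; .assign 5 (.reg 7)) (.assign 5 (.reg 2 +ₑ .const 1)))
      (.assign 5 (.reg 2 +ₑ .const 1))) ;;
  .output (.reg 5 =ₑ .reg 2)

/-- What the current node says about the word `u` when `t` letters have been read. -/
def CheckInv (w u : List (Fin σ)) (t i j : ℕ) : Prop :=
  (IsPair w.length i j ∧ (IsMAS w u ↔ Good w i j (u.drop t))) ∨
    (i = w.length + 1 ∧ (IsMAS w u ↔ u.drop t = [])) ∨ (i = w.length + 2 ∧ ¬ IsMAS w u)

/-- The graph is deterministic, so the query has at most one path, and one table lookup per letter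
follows it. The query is an MAS exactly if the sink is reached with its last letter; a further
letter leads to the failure state. -/
theorem answers_checkCmd {W : ℕ} {w : List (Fin σ)} (hσ : σ ≤ w.length)
    (hW : (w.length + 1) ^ 3 + 10 < W) {s : State} (hin : s.arr .input = inputArray w)
    (hT : IsTable w (s.arr (.data 0))) (hclock : s.clock = 0) (hout : s.out = [])
    (u : List (Fin σ)) (hu : u.length < W) (hq : s.arr .query = load (u.length :: code u)) :
    Answers W checkCmd s fun s' => s'.clock ≤ 100 * (u.length + 1) ∧ s'.Decides (IsMAS w u) := by
  have hW' : w.length + 3 < W := by nlinarith [Nat.zero_le (w.length ^ 3)]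
  have hsize := table_size_le hσ
  suffices h : Ends W checkCmd s fun s' => s'.arr = s.arr ∧ s'.clock ≤ 100 * (u.length + 1) ∧
      s'.Decides (IsMAS w u) by
    obtain ⟨s', h1, h2, h3⟩ := h
    exact ⟨s', h1, ⟨by rw [h2], fun k => by rw [h2]⟩, h3⟩
  have hq0 : s.arr .query 0 = u.length := by rw [hq]; rfl
  have hqt : ∀ t, (ht : t < u.length) → s.arr .query (t + 1) = (u[t] : Fin σ).val + 1 :=
    fun t ht => by rw [hq, load_code _ _ ht]
  refine Ends.seq (Ends.setup hσ (by omega) hin fun s₀ henv harr hout' hclock' => ?_)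
  obtain ⟨h0, h1, h2, -, -⟩ := henv
  refine Ends.seq (Ends.assign ?_ (Ends.seq (Ends.assign ?_ (Ends.seq (Ends.assign ?_
    (Ends.seq (Ends.forLoop (fun t s' => s'.reg 1 = σ ∧ s'.reg 2 = w.length + 1 ∧
      s'.arr = s.arr ∧ s'.out = [] ∧ CheckInv w u t (s'.reg 5) (s'.reg 6))
      u.length 40 ?_ ?_ hu (by omega) (fun _ _ _ h => h) ?_ ?_ ?_)))))))
  · simp [Expr.Fits, Expr.val, harr, hq0]; omega
  · simp [Expr.Fits]; omega
  · simp [Expr.Fits]; omega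
  · simp [Expr.val, harr, hq0]
  · simp
  · simp [h1, h2, harr, hout, hout', Expr.val]
    exact Or.inl ⟨Or.inr ⟨rfl, rfl⟩, by simp [good_zero]⟩
  · rintro t s' ht hx hb ⟨h1, h2, harr, hout, hI⟩
    have hqt := hqt t ht
    have hd := List.drop_eq_getElem_cons ht
    have hut := (u[t]).2
    have h5 : s'.reg 5 ≤ w.length + 2 := by
      rcases hI with ⟨h, -⟩ | ⟨h, -⟩ | ⟨h, -⟩
      · have := h.le; omega
      · omega
      · omega
    refine Ends.cond ?_ (fun hc => ?_) (fun hc => ?_)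
    · simp [Expr.Fits, Expr.val, Op.apply, h2]
      split_ifs <;> omega
    · have hc : s'.reg 5 < w.length + 1 := by
        by_contra h
        simp [Expr.val, Op.apply, h2, h] at hc
      obtain ⟨hp, hiff⟩ : IsPair w.length (s'.reg 5) (s'.reg 6) ∧
          (IsMAS w u ↔ Good w (s'.reg 5) (s'.reg 6) (u.drop t)) := by
        rcases hI with h | ⟨h, -⟩ | ⟨h, -⟩
        · exact h
        · omega
        · omega
      have hij := hp.le
      have htab := hT _ _ hij.1 hij.2 u[t]
      have hle := target_le hij.1 (s'.reg 6) u[t]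
      have hlt := index_lt hij.1 hij.2 hut
      have hb1 : s'.reg 5 * (w.length + 1) ≤ (s'.reg 5 * (w.length + 1) + s'.reg 6) * σ :=
        (Nat.le_add_right _ _).trans (Nat.le_mul_of_pos_right _ (by omega))
      have hb2 : s'.reg 5 * (w.length + 1) + s'.reg 6 ≤
          (s'.reg 5 * (w.length + 1) + s'.reg 6) * σ := Nat.le_mul_of_pos_right _ (by omega)
      rw [hd, good_cons_iff hp] at hiff
      refine Ends.seq (Ends.assign ?_ (Ends.cond ?_ (fun hk => Ends.seq (Ends.assign ?_
        (Ends.assign ?_ ?_))) (fun hk => Ends.assign ?_ ?_)))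
      · simp [Expr.Fits, Expr.val, Op.apply, State.tick, h1, h2, hx, harr, hqt, htab]; omega
      · simp [Expr.Fits, Expr.val, Op.apply, State.tick, h1, h2, hx, harr, hqt, htab]; omega
      · simp [Expr.Fits, State.tick]; omega
      · simp [Expr.Fits, Expr.val, Op.apply, State.tick, h1, h2, hx, harr, hqt, htab]; omega
      · simp [Expr.val, Op.apply, State.tick, h1, h2, hx, harr, hqt, htab] at hk
        simp [Expr.val, Op.apply, State.tick, h1, h2, hx, hb, harr, hqt, htab, hout, Expr.cost]
        by_cases hk' : target w (s'.reg 5) (s'.reg 6) u[t] ≤ w.length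
        · refine Or.inl ⟨IsPair.target hk hk', hiff.trans ⟨?_, fun h => Or.inr ⟨hk, hk', h⟩⟩⟩
          rintro (⟨h, -⟩ | ⟨-, -, h⟩)
          · omega
          · exact h
        · refine Or.inr (Or.inl ⟨by omega, hiff.trans ⟨?_, fun h => Or.inl ⟨by omega, h⟩⟩⟩)
          rintro (⟨-, h⟩ | ⟨-, h, -⟩)
          · exact h
          · omega
      · simp [Expr.Fits, Expr.val, Op.apply, State.tick, h2]; omega
      · simp [Expr.val, Op.apply, State.tick, h1, h2, hx, harr, hqt, htab] at hk
        simp [Expr.val, Op.apply, State.tick, h1, h2, hx, hb, harr, hout, Expr.cost]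
        refine Or.inr (Or.inr ⟨rfl, ?_⟩)
        rw [hiff]
        rintro (⟨h, -⟩ | ⟨h, -⟩)
        · omega
        · exact h hk
    · have hc : w.length + 1 ≤ s'.reg 5 := by
        by_contra h
        simp [Expr.val, Op.apply, h2, Nat.lt_of_not_le h] at hc
      refine Ends.assign ?_ ?_
      · simp [Expr.Fits, Expr.val, Op.apply, State.tick, h2]; omega
      · simp [Expr.val, Op.apply, State.tick, h1, h2, hx, hb, harr, hout, Expr.cost]
        refine Or.inr (Or.inr ⟨rfl, ?_⟩)
        rcases hI with ⟨h, -⟩ | ⟨-, h⟩ | ⟨-, h⟩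
        · have := h.le; omega
        · simpa [h] using ht
        · exact h
  · rintro s' ⟨h1, h2, harr, hout, hI⟩ hcl
    have h5 : s'.reg 5 ≤ w.length + 2 := by
      rcases hI with ⟨h, -⟩ | ⟨h, -⟩ | ⟨h, -⟩
      · have := h.le; omega
      · omega
      · omega
    refine Ends.output ?_ ⟨harr, ?_, ?_⟩
    · simp [Expr.Fits, Expr.val, Op.apply, h2]
      split_ifs <;> omega
    · simp only [Expr.cost] at hcl ⊢; omega
    · simp only [State.Decides, State.written, hout, Expr.val, Op.apply, h2]
      rw [CheckInv, List.drop_length] at hI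
      rcases hI with ⟨h, h'⟩ | ⟨h, h'⟩ | ⟨h, h'⟩
      · right
        have := h.le.1
        exact ⟨fun h => not_good_nil (h'.1 h), by simp; omega⟩
      · exact Or.inl ⟨h'.2 rfl, by simp [h]⟩
      · exact Or.inr ⟨h', by simp [h]⟩

end Check

/-! ### Path lengths -/

section Lengths

variable {σ : ℕ}

/-- Some path of length `t + 1` from `(i, j)` to the sink starts with the letter `a`. -/
def Ext (w : List (Fin σ)) (t i j : ℕ) (a : Fin σ) : Prop :=
  ∃ u : List (Fin σ), u.length = t ∧ Good w i j (a :: u)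

theorem ext_zero_iff {w : List (Fin σ)} {i j : ℕ} (hp : IsPair w.length i j) {a : Fin σ} :
    Ext w 0 i j a ↔ target w i j a = w.length + 1 := by
  constructor
  · rintro ⟨u, hu, h⟩
    obtain rfl := List.eq_nil_of_length_eq_zero hu
    rcases (good_cons_iff hp).1 h with ⟨h, -⟩ | ⟨-, -, h⟩
    · exact h
    · exact absurd h not_good_nil
  · exact fun h => ⟨[], rfl, (good_cons_iff hp).2 (Or.inl ⟨h, rfl⟩)⟩

/-- The recursion of the dynamic program: a row depends only on the row of the next smaller length.
-/
theorem ext_succ_iff {w : List (Fin σ)} {t i j : ℕ} (hp : IsPair w.length i j) {a : Fin σ} :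
    Ext w (t + 1) i j a ↔ target w i j a ≠ 0 ∧ target w i j a ≤ w.length ∧
      ∃ b, Ext w t (target w i j a) i b := by
  constructor
  · rintro ⟨u, hu, h⟩
    cases u with
    | nil => simp at hu
    | cons b u =>
      rcases (good_cons_iff hp).1 h with ⟨-, h⟩ | ⟨h1, h2, h3⟩
      · simp at h
      · exact ⟨h1, h2, b, u, by simpa using hu, h3⟩
  · rintro ⟨h1, h2, b, u, hu, h3⟩
    exact ⟨b :: u, by simp [hu], (good_cons_iff hp).2 (Or.inr ⟨h1, h2, h3⟩)⟩

/-- `v` is `0` if there is no path of length `t + 1` from `(i, j)` to the sink that starts with a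
letter below `b`, and otherwise `v` is the code of the first letter of such a path. -/
def IsCell (w : List (Fin σ)) (t i j b v : ℕ) : Prop :=
  v ≤ b ∧ (IsPair w.length i j → (∀ a : Fin σ, v = a + 1 → Ext w t i j a) ∧
    (v = 0 → ∀ a : Fin σ, a.val < b → ¬ Ext w t i j a))

theorem IsCell.zero (w : List (Fin σ)) (t i j : ℕ) : IsCell w t i j 0 0 :=
  ⟨le_rfl, fun _ => ⟨fun a h => by omega, fun _ a h => by omega⟩⟩

theorem IsCell.of_ext {w : List (Fin σ)} {t i j : ℕ} {b : Fin σ}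
    (h : IsPair w.length i j → Ext w t i j b) : IsCell w t i j (b + 1) (b + 1) :=
  ⟨le_rfl, fun hp => ⟨fun a ha => by
    obtain rfl : b = a := Fin.ext (by omega)
    exact h hp, fun h => by omega⟩⟩

theorem IsCell.of_not_ext {w : List (Fin σ)} {t i j v : ℕ} {b : Fin σ}
    (hv : IsCell w t i j b v) (h : IsPair w.length i j → ¬ Ext w t i j b) :
    IsCell w t i j (b + 1) v := by
  refine ⟨hv.1.trans (by omega), fun hp => ⟨(hv.2 hp).1, fun h0 a ha => ?_⟩⟩
  rcases Nat.lt_succ_iff_lt_or_eq.1 ha with h1 | h1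
  · exact (hv.2 hp).2 h0 a h1
  · obtain rfl : a = b := Fin.ext h1
    exact h hp

theorem IsCell.ne_zero_iff {w : List (Fin σ)} {t i j v : ℕ} (h : IsCell w t i j σ v)
    (hp : IsPair w.length i j) : v ≠ 0 ↔ ∃ a, Ext w t i j a := by
  constructor
  · intro hv
    have := h.1
    exact ⟨⟨v - 1, by omega⟩, (h.2 hp).1 _ (by simp only; omega)⟩
  · rintro ⟨a, ha⟩ hv
    exact (h.2 hp).2 hv a a.2 ha

/-- The body of the inner loop of `fillLengths`: extend the paths from `(i, j)` by a letter. -/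
def tryLetter : Cmd :=
  .assign 10 (.read (.data 0) ((.reg 6 *ₑ .reg 2 +ₑ .reg 7) *ₑ .reg 1 +ₑ .reg 9)) ;;
  .cond (.reg 5 =ₑ .const 0)
    (.cond (.reg 10 =ₑ .reg 2) (.assign 8 (.reg 9 +ₑ .const 1)) .skip)
    (.cond ((.const 0 <ₑ .reg 10) *ₑ (.reg 10 <ₑ .reg 2))
      (.cond (.read (.work 0) (((.reg 5 -ₑ .const 1) *ₑ .reg 2 +ₑ .reg 10) *ₑ .reg 2 +ₑ .reg 6))
        (.assign 8 (.reg 9 +ₑ .const 1)) .skip)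
      .skip)

/-- Cell `(t * (n + 1) + i) * (n + 1) + j` of the array `work 0` gets the code of the first letter
of a path of length `t + 1` from `(i, j)` to the sink, if there is one, and `0` otherwise. -/
def fillLengths : Cmd :=
  .assign 3 (.reg 2 *ₑ .reg 2 *ₑ .reg 2) ;;
  forLoop 4 3
    (.assign 5 (.reg 4 /ₑ .reg 2 /ₑ .reg 2) ;; .assign 6 (.reg 4 /ₑ .reg 2 %ₑ .reg 2) ;;
      .assign 7 (.reg 4 %ₑ .reg 2) ;; .assign 8 (.const 0) ;; forLoop 9 1 tryLetter ;;
      .store (.work 0) (.reg 4) (.reg 8))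

/-- The loops also run over pairs `(i, j)` that are not nodes. For these `IsCell` retains only its
bound on the value, which still rules out overflow. The product of two truth values in the program
is a conjunction. -/
theorem Ends.tryLetter {W : ℕ} {w : List (Fin σ)} {t i j v : ℕ} {s : State} {Q : State → Prop}
    (hσ : σ ≤ w.length) (hW : (w.length + 1) ^ 3 + 10 < W) (ht : t ≤ w.length)
    (hi : i ≤ w.length) (hj : j ≤ w.length) (a : Fin σ) (h1 : s.reg 1 = σ)
    (h2 : s.reg 2 = w.length + 1) (h5 : s.reg 5 = t) (h6 : s.reg 6 = i) (h7 : s.reg 7 = j)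
    (h8 : s.reg 8 = v) (h9 : s.reg 9 = a) (hT : IsTable w (s.arr (.data 0)))
    (hL : ∀ k, 1 ≤ t → k ≤ w.length →
      IsCell w (t - 1) k i σ (s.arr (.work 0) (((t - 1) * (w.length + 1) + k) * (w.length + 1) + i)))
    (hv : IsCell w t i j a v)
    (h : ∀ s', (∀ x, x ≠ 8 → x ≠ 10 → s'.reg x = s.reg x) → s'.arr = s.arr → s'.out = s.out →
      s'.clock ≤ s.clock + 50 → IsCell w t i j (a + 1) (s'.reg 8) → Q s') :
    Ends W tryLetter s Q := by
  have hsize := table_size_le hσ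
  have htab := hT i j hi hj a
  have hle := target_le hi j a
  have hlt := index_lt hi hj a.2
  have hσ0 : 0 < σ := a.pos
  have hb1 : i * (w.length + 1) ≤ (i * (w.length + 1) + j) * σ :=
    (Nat.le_add_right _ _).trans (Nat.le_mul_of_pos_right _ hσ0)
  have hb2 : i * (w.length + 1) + j ≤ (i * (w.length + 1) + j) * σ :=
    Nat.le_mul_of_pos_right _ hσ0
  have hW' : w.length + 3 < W := by nlinarith [Nat.zero_le (w.length ^ 3)]
  have ha := a.2
  have hyes : (IsPair w.length i j → Ext w t i j a) → IsCell w t i j (a + 1) (a + 1) := IsCell.of_ext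
  have hno := hv.of_not_ext (b := a)
  generalize hk : target w i j a = k at *
  refine Ends.seq (Ends.assign ?_ (Ends.cond ?_ (fun hc => Ends.cond ?_
    (fun hc' => Ends.assign ?_ (h _ ?_ rfl rfl ?_ ?_)) (fun hc' => Ends.skip (h _ ?_ rfl rfl ?_ ?_)))
    (fun hc => ?_)))
  · simp [Expr.Fits, Expr.val, Op.apply, h1, h2, h6, h7, h9, htab]; omega
  · simp [Expr.Fits, Expr.val, Op.apply, h5]; split_ifs <;> omega
  · simp [Expr.Fits, Expr.val, Op.apply, State.tick, h1, h2, h6, h7, h9, htab]; split_ifs <;> omega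
  · simp [Expr.Fits, Expr.val, Op.apply, State.tick, h9]; omega
  · intro x hx hx'; simp [State.tick, hx, hx']
  · simp [State.tick, Expr.cost]
  · simp [Expr.val, Op.apply, h5] at hc
    simp [Expr.val, Op.apply, State.tick, h1, h2, h6, h7, h9, htab] at hc'
    simp [Expr.val, Op.apply, State.tick, h9]
    refine hyes fun hp => ?_
    rw [hc, ext_zero_iff hp, hk, hc']
  · intro x hx hx'; simp [State.tick, hx']
  · simp [State.tick, Expr.cost]
  · simp [Expr.val, Op.apply, h5] at hc
    simp [Expr.val, Op.apply, State.tick, h1, h2, h6, h7, h9, htab] at hc'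
    simp [State.tick, h8]
    refine hno fun hp => ?_
    rw [hc, ext_zero_iff hp, hk]; exact hc'
  · simp [Expr.val, Op.apply, h5] at hc
    obtain ⟨t, rfl⟩ : ∃ m, t = m + 1 := ⟨t - 1, by omega⟩
    simp only [Nat.add_sub_cancel] at hL
    refine Ends.cond ?_ (fun hc' => ?_) (fun hc' => Ends.skip (h _ ?_ rfl rfl ?_ ?_))
    · simp [Expr.Fits, Expr.val, Op.apply, State.tick, h1, h2, h6, h7, h9, htab]
      split_ifs <;> omega
    · have hc' : k ≠ 0 ∧ k ≤ w.length := by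
        simp [Expr.val, Op.apply, State.tick, h1, h2, h6, h7, h9, htab] at hc'; omega
      have hcell := hL k (by omega) hc'.2
      have hc1 := hcell.1
      have hx1 : (t * (w.length + 1) + k) * (w.length + 1) + i < (w.length + 1) ^ 3 := by
        have := mul_add_lt (mul_add_lt (show t < w.length + 1 by omega)
          (show k < w.length + 1 by omega)) (show i < w.length + 1 by omega)
        rw [pow_succ, pow_two]; exact this
      have hx2 : t * (w.length + 1) + k ≤ (t * (w.length + 1) + k) * (w.length + 1) :=
        Nat.le_mul_of_pos_right _ (by omega)
      have hext : IsPair w.length i j → (Ext w (t + 1) i j a ↔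
          s.arr (.work 0) ((t * (w.length + 1) + k) * (w.length + 1) + i) ≠ 0) := by
        intro hp
        have hpk : IsPair w.length k i := hk ▸ IsPair.target (hk ▸ hc'.1) (hk ▸ hc'.2)
        rw [ext_succ_iff hp, hcell.ne_zero_iff hpk, hk]
        exact ⟨fun h => h.2.2, fun h => ⟨hc'.1, hc'.2, h⟩⟩
      refine Ends.cond ?_ (fun hc'' => Ends.assign ?_ (h _ ?_ rfl rfl ?_ ?_))
        (fun hc'' => Ends.skip (h _ ?_ rfl rfl ?_ ?_))
      · simp [Expr.Fits, Expr.val, Op.apply, State.tick, h1, h2, h5, h6, h7, h9, htab]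
        omega
      · simp [Expr.Fits, Expr.val, Op.apply, State.tick, h9]; omega
      · intro x hx hx'; simp [State.tick, hx, hx']
      · simp [State.tick, Expr.cost]
      · simp [Expr.val, Op.apply, State.tick, h1, h2, h5, h6, h7, h9, htab] at hc''
        simp [Expr.val, Op.apply, State.tick, h9]
        exact hyes fun hp => (hext hp).2 hc''
      · intro x hx hx'; simp [State.tick, hx']
      · simp [State.tick, Expr.cost]
      · simp [Expr.val, Op.apply, State.tick, h1, h2, h5, h6, h7, h9, htab] at hc''
        simp [State.tick, h8]
        exact hno fun hp h => (hext hp).1 h hc''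
    · intro x hx hx'; simp [State.tick, hx']
    · simp [State.tick, Expr.cost]
    · simp [Expr.val, Op.apply, State.tick, h1, h2, h6, h7, h9, htab] at hc'
      simp [State.tick, h8]
      refine hno fun hp h => ?_
      have := (ext_succ_iff hp).1 h
      rw [hk] at this; omega

theorem Ends.fillLengths {W : ℕ} {w : List (Fin σ)} {D : ℕ → ℕ → ℕ} {s : State}
    {Q : State → Prop} (hσ : σ ≤ w.length) (hW : (w.length + 1) ^ 3 + 10 < W)
    (henv : Env w D s) (hT : IsTable w (D 0))
    (h : ∀ s', Env w D s' → s'.arr .query = s.arr .query → s'.out = s.out →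
      (∀ t i j, t ≤ w.length → i ≤ w.length → j ≤ w.length → IsCell w t i j σ
        (s'.arr (.work 0) ((t * (w.length + 1) + i) * (w.length + 1) + j))) →
      s'.clock ≤ s.clock + ((w.length + 1) ^ 3 * (σ * 58 + 48) + 12) → Q s') :
    Ends W fillLengths s Q := by
  obtain ⟨h0, h1, h2, hin, hD⟩ := henv
  set n := w.length with hn
  have hcube : (n + 1) * (n + 1) * (n + 1) = (n + 1) ^ 3 := by ring
  have hnn : n + 1 ≤ (n + 1) * (n + 1) := Nat.le_mul_of_pos_left _ (by omega)
  have hle : (n + 1) * (n + 1) ≤ (n + 1) * (n + 1) * (n + 1) := Nat.le_mul_of_pos_right _ (by omega)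
  refine Ends.seq (Ends.assign ?_ ?_)
  · simp only [Expr.Fits, Expr.val, Op.apply, h2]; omega
  refine Ends.forLoop
    (fun p s' => Env w D s' ∧ s'.arr .query = s.arr .query ∧ s'.out = s.out ∧
      ∀ t i j, t ≤ n → i ≤ n → j ≤ n → (t * (n + 1) + i) * (n + 1) + j < p →
        IsCell w t i j σ (s'.arr (.work 0) ((t * (n + 1) + i) * (n + 1) + j)))
    ((n + 1) ^ 3) (σ * 58 + 40) ?_ (by simp) (by omega) (by omega)
    (fun _ _ _ h => ⟨⟨h.1.1, h.1.2, h.1.3, h.1.4, h.1.5⟩, h.2⟩) ?_ ?_ ?_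
  · simp [Expr.val, Op.apply, h2, hcube]
  · refine fun k => ⟨⟨?_, ?_, ?_, ?_, ?_⟩, ?_⟩ <;> simp [h0, h1, h2, hin, hD, hn]
  · rintro p s₁ hp hx hb ⟨⟨h0, h1, h2, hin, hD⟩, hq, ho, hL⟩
    rw [← hn] at h0 h2
    have hpd : p / (n + 1) < (n + 1) * (n + 1) :=
      (Nat.div_lt_iff_lt_mul (by omega)).2 (by rw [hcube]; exact hp)
    have ht : p / (n + 1) / (n + 1) < n + 1 := (Nat.div_lt_iff_lt_mul (by omega)).2 hpd
    have hi : p / (n + 1) % (n + 1) < n + 1 := Nat.mod_lt _ (by omega)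
    have hj : p % (n + 1) < n + 1 := Nat.mod_lt _ (by omega)
    have hsplit : p = (p / (n + 1) / (n + 1) * (n + 1) + p / (n + 1) % (n + 1)) * (n + 1) +
        p % (n + 1) := by
      rw [Nat.div_add_mod', Nat.div_add_mod']
    have hdec : ∀ t i j, i ≤ n → j ≤ n → (t * (n + 1) + i) * (n + 1) + j = p →
        t = p / (n + 1) / (n + 1) ∧ i = p / (n + 1) % (n + 1) ∧ j = p % (n + 1) := by
      intro t i j hi hj h
      have e1 := mul_add_div_eq (i := t * (n + 1) + i) (show j < n + 1 by omega)
      have e2 := mul_add_mod_eq (i := t * (n + 1) + i) (show j < n + 1 by omega)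
      rw [h] at e1 e2
      rw [e1, e2, mul_add_div_eq (by omega), mul_add_mod_eq (by omega)]
      exact ⟨rfl, rfl, rfl⟩
    have hd1 : p / (n + 1) ≤ p := Nat.div_le_self _ _
    generalize heq : p / (n + 1) = q at *
    generalize het : q / (n + 1) = t at *
    generalize hei : q % (n + 1) = i at *
    generalize hej : p % (n + 1) = j at *
    refine Ends.seq (Ends.assign ?_ (Ends.seq (Ends.assign ?_ (Ends.seq (Ends.assign ?_
      (Ends.seq (Ends.assign ?_ (Ends.seq (Ends.forLoop
        (fun a s' => s'.reg 0 = n ∧ s'.reg 1 = σ ∧ s'.reg 2 = n + 1 ∧ s'.reg 3 = (n + 1) ^ 3 ∧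
          s'.reg 4 = p ∧ s'.reg 5 = t ∧ s'.reg 6 = i ∧ s'.reg 7 = j ∧ s'.arr = s₁.arr ∧
          s'.out = s.out ∧ IsCell w t i j a (s'.reg 8))
        σ 50 ?_ (by simp) (by omega) (by omega) (fun _ _ _ h => h) ?_ ?_ ?_)))))))))
    · simp [Expr.Fits, Expr.val, Op.apply, h2, hx, heq, het]; omega
    · simp [Expr.Fits, Expr.val, Op.apply, h2, hx, heq, hei]; omega
    · simp [Expr.Fits, Expr.val, Op.apply, h2, hx, hej]; omega
    · simp [Expr.Fits]; omega
    · simp [h1]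
    · simp [Expr.val, Op.apply, h0, h1, h2, hx, hb, heq, het, hei, hej, ho, IsCell.zero]
    · rintro a s' ha hx' - ⟨g0, g1, g2, g3, g4, g5, g6, g7, garr, gout, gc⟩
      refine Ends.tryLetter (W := W) hσ hW (t := t) (i := i) (j := j) (by omega) (by omega) (by omega)
        ⟨a, ha⟩ g1 g2 g5 g6 g7 rfl hx' ?_ ?_ gc fun s'' hreg harr hout hcl hcell => ?_
      · rw [garr, hD]; exact hT
      · intro k ht1 hk
        rw [garr]
        -- All cells of row `t - 1` precede the current cell `p`, so they are final.
        refine hL (t - 1) k i (by omega) hk (by omega) ?_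
        have := mul_add_lt (mul_add_lt (show t - 1 < t by omega)
          (show k < n + 1 by omega)) (show i < n + 1 by omega)
        have e := Nat.add_mul (t * (n + 1)) i (n + 1)
        omega
      · refine ⟨?_, ?_, hcl, ?_⟩
        · rw [hreg _ (by simp) (by simp), hx']
        · rw [hreg _ (by simp) (by simp), g1]
        · simpa [hreg, harr, hout, g0, g1, g2, g3, g4, g5, g6, g7, garr, gout] using hcell
    · rintro s' ⟨g0, g1, g2, g3, g4, g5, g6, g7, garr, gout, gc⟩ hcl
      refine Ends.store ?_ ?_ ?_
      · simp [Expr.Fits, g4]; omega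
      · have := gc.1
        simp [Expr.Fits]; omega
      · refine ⟨by simp [g4], by simp [g3], ?_, ⟨?_, ?_, ?_, ?_, ?_⟩, ?_, ?_, ?_⟩
        · simp only [Expr.cost] at hcl ⊢; omega
        · simp [g0, hn]
        · simp [g1]
        · simp [g2, hn]
        · simp [garr, hin]
        · simp [garr, hD]
        · simp [garr, hq]
        · simp [gout]
        · intro t' i' j' ht' hi' hj' hlt
          simp only [Expr.val, g4, Function.update_self]
          by_cases he : (t' * (n + 1) + i') * (n + 1) + j' = p
          · obtain ⟨rfl, rfl, rfl⟩ := hdec t' i' j' hi' hj' he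
            rw [he, Function.update_self]; exact gc
          · rw [Function.update_of_ne he, garr]
            exact hL t' i' j' ht' hi' hj' (by omega)
  · rintro s' ⟨henv, hq, ho, hL⟩ hcl
    refine h s' henv hq ho (fun t i j ht hi hj => hL t i j ht hi hj ?_) ?_
    · rw [← hcube]
      exact mul_add_lt (mul_add_lt (by omega) (by omega)) (by omega)
    · simp only [Expr.cost, Nat.add_assoc (σ * 58), Nat.reduceAdd] at hcl; omega

end Lengths

/-! ### A longest minimal absent subsequence, and those of a given length -/

section Longest

variable {σ : ℕ}

theorem isPair_zero (n : ℕ) : IsPair n 0 0 := Or.inr ⟨rfl, rfl⟩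

theorem exists_ext_zero_iff {w : List (Fin σ)} {t : ℕ} :
    (∃ a, Ext w t 0 0 a) ↔ ∃ v, IsMAS w v ∧ v.length = t + 1 := by
  constructor
  · rintro ⟨a, u, hu, h⟩
    exact ⟨a :: u, good_zero.1 h, by simp [hu]⟩
  · rintro ⟨v, hv, hl⟩
    cases v with
    | nil => simp at hl
    | cons a u => exact ⟨a, u, by simpa using hl, good_zero.2 hv⟩

theorem IsMAS.length_le {w v : List (Fin σ)} (h : IsMAS w v) : v.length ≤ w.length + 1 := by
  simpa using (good_zero.2 h).length_le (isPair_zero _)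

theorem IsMAS.length_pos {w v : List (Fin σ)} (h : IsMAS w v) : 0 < v.length := by
  rw [List.length_pos_iff]
  rintro rfl
  exact not_good_nil (good_zero.2 h)

/-- The first summand is the time of `fillLengths`; `66 = 18 + 48` is the time per round of the two
loops of `longestCmd`. -/
theorem lengths_time_le {n : ℕ} (hσ : σ ≤ n) :
    (n + 1) ^ 3 * (σ * 58 + 48) + (n + 1) * 66 + 60 ≤ 300 * (n + 1) ^ 4 := by
  have h1 : (n + 1) ^ 3 * (σ * 58 + 48) ≤ (n + 1) ^ 3 * (106 * (n + 1)) :=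
    Nat.mul_le_mul_left _ (by omega)
  have h2 : (n + 1) ^ 3 * (106 * (n + 1)) = 106 * (n + 1) ^ 4 := by ring
  have h3 : n + 1 ≤ (n + 1) ^ 4 := Nat.le_self_pow (by simp) _
  omega

/-- Decide whether there is a minimal absent subsequence of a given length. -/
def ofLengthCmd : Cmd :=
  setup ;; fillLengths ;; .assign 3 (.read .query (.const 0)) ;;
  .cond ((.reg 3 =ₑ .const 0) +ₑ (.reg 2 <ₑ .reg 3)) (.output (.const 0))
    (.output (.const 0 <ₑ .read (.work 0) ((.reg 3 -ₑ .const 1) *ₑ .reg 2 *ₑ .reg 2)))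

theorem root_index_lt {n t : ℕ} (ht : t ≤ n) : t * (n + 1) * (n + 1) < (n + 1) ^ 3 := by
  have := mul_add_lt (mul_add_lt (show t < n + 1 by omega) (Nat.succ_pos n)) (Nat.succ_pos n)
  rw [pow_succ, pow_two]
  simpa using this

/-- An MAS has between `1` and `n + 1` letters, so other lengths are rejected at once; for the rest
the cell of the source in row `l - 1` decides. -/
theorem answers_ofLengthCmd {W : ℕ} {w : List (Fin σ)} (hσ : σ ≤ w.length)
    (hW : (w.length + 1) ^ 3 + 10 < W) {s : State} (hin : s.arr .input = inputArray w)
    (hT : IsTable w (s.arr (.data 0))) (hclock : s.clock = 0) (hout : s.out = [])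
    (l : ℕ) (hl : l < W) (hq : s.arr .query = load [l]) :
    Answers W ofLengthCmd s fun s' => s'.clock ≤ 300 * (w.length + 1) ^ 4 ∧
      s'.Decides (∃ v, IsMAS w v ∧ v.length = l) := by
  have hW' : w.length + 3 < W := by nlinarith [Nat.zero_le (w.length ^ 3)]
  have htime := lengths_time_le hσ
  refine Ends.seq (Ends.setup hσ (by omega) hin fun s₀ henv harr hout' hclock' => ?_)
  refine Ends.seq (Ends.fillLengths hσ hW henv hT fun s₂ henv₂ hq₂ ho₂ hL hcl₂ => ?_)
  have hq0 : s₂.arr .query 0 = l := by rw [hq₂, harr, hq]; rfl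
  obtain ⟨h0, h1, h2, hin₂, hD₂⟩ := henv₂
  rw [hout', hout] at ho₂
  have hsame : SameData s s₂ := ⟨by rw [hin₂, hin], hD₂⟩
  refine Ends.seq (Ends.assign ?_ (Ends.cond ?_ (fun hc => Ends.output ?_ ⟨hsame, ?_, ?_⟩)
    (fun hc => Ends.output ?_ ⟨hsame, ?_, ?_⟩)))
  · simp [Expr.Fits, Expr.val, hq0, hl]; omega
  · simp [Expr.Fits, Expr.val, Op.apply, hq0, h2]
    split_ifs <;> omega
  · simp [Expr.Fits]; omega
  · simp [Expr.cost, State.tick]; omega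
  · right
    refine ⟨?_, by simp [State.written, State.tick, Expr.val, ho₂]⟩
    simp [Expr.val, Op.apply, hq0, h2] at hc
    rintro ⟨v, hv, rfl⟩
    have := hv.length_le
    have := hv.length_pos
    omega
  all_goals
    have hc : 1 ≤ l ∧ l ≤ w.length + 1 := by
      simp [Expr.val, Op.apply, hq0, h2] at hc; omega
    have hcell := hL (l - 1) 0 0 (by omega) (by omega) (by omega)
    simp only [Nat.add_zero] at hcell
    have hc1 := hcell.1
    have hx := root_index_lt (n := w.length) (t := l - 1) (by omega)
    have hx' : (l - 1) * (w.length + 1) ≤ (l - 1) * (w.length + 1) * (w.length + 1) :=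
      Nat.le_mul_of_pos_right _ (by omega)
  · simp [Expr.Fits, Expr.val, Op.apply, State.tick, hq0, h2]
    split_ifs <;> omega
  · simp [Expr.cost, State.tick]; omega
  · have hiff := hcell.ne_zero_iff (isPair_zero _)
    rw [exists_ext_zero_iff, Nat.sub_add_cancel hc.1] at hiff
    simp only [State.Decides, State.written, State.tick, Expr.val, Op.apply, ho₂, hq0,
      ← hiff]
    simp [h2, Nat.pos_iff_ne_zero]
    tauto

/-- Output a longest minimal absent subsequence: register `5` gets the number of the last row of
the table of lengths that contains a path from the source, and this path is followed. -/
def longestCmd : Cmd :=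
  setup ;; fillLengths ;; .assign 5 (.const 0) ;;
  forLoop 4 2
    (.cond (.read (.work 0) (.reg 4 *ₑ .reg 2 *ₑ .reg 2)) (.assign 5 (.reg 4)) .skip) ;;
  .assign 3 (.reg 5 +ₑ .const 1) ;; .assign 6 (.const 0) ;; .assign 7 (.const 0) ;;
  forLoop 4 3
    (.assign 8
        (.read (.work 0) (((.reg 5 -ₑ .reg 4) *ₑ .reg 2 +ₑ .reg 6) *ₑ .reg 2 +ₑ .reg 7)) ;;
      .output (.reg 8) ;;
      .assign 9
        (.read (.data 0) ((.reg 6 *ₑ .reg 2 +ₑ .reg 7) *ₑ .reg 1 +ₑ (.reg 8 -ₑ .const 1))) ;;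
      .assign 7 (.reg 6) ;; .assign 6 (.reg 9))

/-- The word `pre` has been written, and the current node continues it to a minimal absent
subsequence of length `m + 1`. -/
def WalkInv (w : List (Fin σ)) (m t i j : ℕ) (out : List ℕ) : Prop :=
  ∃ pre : List (Fin σ), out = code pre ∧ pre.length = t ∧
    (t ≤ m → IsPair w.length i j ∧ (∃ a, Ext w (m - t) i j a) ∧
      ∀ u, Good w i j u → IsMAS w (pre ++ u)) ∧
    (t = m + 1 → IsMAS w pre)

/-- After `t` letters the row in use is `m - t`. A letter that its cell offers leads to a node with
a path in the row below, or, if the row is `0`, to the sink. -/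
theorem WalkInv.step {w : List (Fin σ)} {m t i j : ℕ} {out : List ℕ}
    (h : WalkInv w m t i j out) (ht : t ≤ m) {a : Fin σ} (ha : Ext w (m - t) i j a) :
    WalkInv w m (t + 1) (target w i j a) i (out ++ [a.val + 1]) := by
  obtain ⟨pre, rfl, rfl, h, -⟩ := h
  obtain ⟨hp, -, hmas⟩ := h ht
  refine ⟨pre ++ [a], by simp [code_eq_map], by simp, fun hlt => ?_, fun heq => ?_⟩
  · obtain ⟨r, hr⟩ : ∃ r, m - pre.length = r + 1 := ⟨m - pre.length - 1, by omega⟩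
    rw [hr, ext_succ_iff hp] at ha
    obtain ⟨h1, h2, h3⟩ := ha
    refine ⟨IsPair.target h1 h2, ?_, fun u hu => ?_⟩
    · rwa [show m - (pre.length + 1) = r by omega]
    · rw [List.append_assoc]
      exact hmas _ ((good_cons_iff hp).2 (Or.inr ⟨h1, h2, hu⟩))
  · rw [show m - pre.length = 0 by omega, ext_zero_iff hp] at ha
    exact hmas _ ((good_cons_iff hp).2 (Or.inl ⟨ha, rfl⟩))

theorem answers_longestCmd {W : ℕ} {w : List (Fin σ)} (hσ₁ : 1 ≤ σ) (hσ : σ ≤ w.length)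
    (hW : (w.length + 1) ^ 3 + 10 < W) {s : State} (hin : s.arr .input = inputArray w)
    (hT : IsTable w (s.arr (.data 0))) (hclock : s.clock = 0) (hout : s.out = []) :
    Answers W longestCmd s fun s' => s'.clock ≤ 300 * (w.length + 1) ^ 4 ∧
      ∃ v, IsMAS w v ∧ (∀ v', IsMAS w v' → v'.length ≤ v.length) ∧ s'.written = code v := by
  have hW' : w.length + 3 < W := by nlinarith [Nat.zero_le (w.length ^ 3)]
  have htime := lengths_time_le hσ
  have hsize := table_size_le hσ
  refine Ends.seq (Ends.setup hσ (by omega) hin fun s₀ henv harr hout' hclock' => ?_)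
  refine Ends.seq (Ends.fillLengths hσ hW henv hT fun s₂ henv₂ hq₂ ho₂ hL hcl₂ => ?_)
  obtain ⟨h0, h1, h2, hin₂, hD₂⟩ := henv₂
  rw [hout', hout] at ho₂
  have hsame : SameData s s₂ := ⟨by rw [hin₂, hin], hD₂⟩
  have hroot := fun t ht => hL t 0 0 ht (by omega) (by omega)
  simp only [Nat.add_zero] at hroot
  have hrootx := fun t ht => root_index_lt (n := w.length) (t := t) ht
  have hrootx' : ∀ t, t * (w.length + 1) ≤ t * (w.length + 1) * (w.length + 1) :=
    fun t => Nat.le_mul_of_pos_right _ (by omega)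
  refine Ends.seq (Ends.assign ?_ (Ends.seq (Ends.forLoop
    (fun t s' => s'.reg 1 = σ ∧ s'.reg 2 = w.length + 1 ∧ s'.arr = s₂.arr ∧ s'.out = [] ∧
      s'.reg 5 ≤ w.length ∧ ∀ t' < t, s₂.arr (.work 0) (t' * (w.length + 1) * (w.length + 1)) ≠ 0 →
        t' ≤ s'.reg 5 ∧
          s₂.arr (.work 0) (s'.reg 5 * (w.length + 1) * (w.length + 1)) ≠ 0)
    (w.length + 1) 10 ?_ (by simp) (by omega) (by omega) (fun _ _ _ h => h) ?_ ?_ ?_)))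
  · simp [Expr.Fits]; omega
  · simp [h2]
  · simp [h1, h2, ho₂, Expr.val]
  · rintro t s' ht hx hb ⟨g1, g2, garr, gout, g5, gmax⟩
    have hc1 := (hroot t (by omega)).1
    have hx1 := hrootx t (by omega)
    have hx2 := hrootx' t
    refine Ends.cond ?_ (fun hc => Ends.assign ?_ ?_) (fun hc => Ends.skip ?_)
    · simp [Expr.Fits, Expr.val, Op.apply, hx, g2, garr]; omega
    · simp [Expr.Fits, State.tick, hx]; omega
    · simp [Expr.val, Op.apply, hx, g2, garr] at hc
      simp [State.tick, Expr.val, Expr.cost, hx, g1, g2, garr, gout]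
      exact ⟨by omega, fun t' ht' _ => ⟨by omega, hc⟩⟩
    · simp [Expr.val, Op.apply, hx, g2, garr] at hc
      simp [State.tick, Expr.cost, hx, g1, g2, garr, gout, g5]
      intro t' ht' hne
      refine gmax t' ?_ hne
      rcases Nat.lt_or_ge t' t with h | h
      · exact h
      · obtain rfl : t' = t := by omega
        exact absurd hc hne
  · rintro s' ⟨g1, g2, garr, gout, g5, gmax⟩ gcl
    -- Some MAS exists, so the search over the rows has found a nonzero cell and register `5` is not
    -- just its initial value.
    obtain ⟨v₀, hv₀⟩ := exists_good (w := w) hσ₁ (isPair_zero _)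
    rw [good_zero] at hv₀
    have hmax : ∀ v, IsMAS w v → v.length ≤ s'.reg 5 + 1 ∧
        s₂.arr (.work 0) (s'.reg 5 * (w.length + 1) * (w.length + 1)) ≠ 0 := by
      intro v hv
      have l1 := hv.length_le
      have l2 := hv.length_pos
      have := gmax (v.length - 1) (by omega)
        (((hroot (v.length - 1) (by omega)).ne_zero_iff (isPair_zero _)).2
          (exists_ext_zero_iff.2 ⟨v, hv, by omega⟩))
      exact ⟨by omega, this.2⟩
    have hstart := ((hroot (s'.reg 5) g5).ne_zero_iff (isPair_zero _)).1 (hmax v₀ hv₀).2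
    generalize hm : s'.reg 5 = m at *
    refine Ends.seq (Ends.assign ?_ (Ends.seq (Ends.assign ?_ (Ends.seq (Ends.assign ?_
      (Ends.forLoop (fun t s' => s'.reg 1 = σ ∧ s'.reg 2 = w.length + 1 ∧ s'.reg 5 = m ∧
        s'.arr = s₂.arr ∧ WalkInv w m t (s'.reg 6) (s'.reg 7) s'.written)
      (m + 1) 40 ?_ (by simp) (by omega) (by omega) (fun _ _ _ h => h) ?_ ?_ ?_))))))
    · simp [Expr.Fits, Expr.val, Op.apply, hm]; omega
    · simp [Expr.Fits]; omega
    · simp [Expr.Fits]; omega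
    · simp [Expr.val, Op.apply, hm]
    · intro k
      simp [Expr.val, g1, g2, hm, garr, State.written, gout]
      exact ⟨[], rfl, rfl, fun _ => ⟨isPair_zero _, hstart, fun u hu => good_zero.1 hu⟩,
        fun h => by omega⟩
    · rintro t s₃ ht hx hb ⟨f1, f2, f5, farr, finv⟩
      obtain ⟨hp, hext⟩ : IsPair w.length (s₃.reg 6) (s₃.reg 7) ∧
          ∃ a, Ext w (m - t) (s₃.reg 6) (s₃.reg 7) a := by
        obtain ⟨pre, -, -, h, -⟩ := finv
        exact ⟨(h (by omega)).1, (h (by omega)).2.1⟩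
      generalize hi : s₃.reg 6 = i at *
      generalize hj : s₃.reg 7 = j at *
      have hij := hp.le
      have hcell := hL (m - t) i j (by omega) hij.1 hij.2
      have hc0 := (hcell.ne_zero_iff hp).2 hext
      have hc1 := hcell.1
      have hlt : ((m - t) * (w.length + 1) + i) * (w.length + 1) + j < (w.length + 1) ^ 3 := by
        have := mul_add_lt (mul_add_lt (show m - t < w.length + 1 by omega)
          (show i < w.length + 1 by omega)) (show j < w.length + 1 by omega)
        rw [pow_succ, pow_two]; exact this
      have hlt' : (m - t) * (w.length + 1) + i ≤ ((m - t) * (w.length + 1) + i) * (w.length + 1) :=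
        Nat.le_mul_of_pos_right _ (by omega)
      obtain ⟨a, ha⟩ : ∃ a : Fin σ,
          s₂.arr (.work 0) (((m - t) * (w.length + 1) + i) * (w.length + 1) + j) = a + 1 :=
        ⟨⟨_ - 1, by omega⟩, (Nat.sub_add_cancel (Nat.pos_of_ne_zero hc0)).symm⟩
      have hexta := (hcell.2 hp).1 a ha
      have hat := a.2
      have hdata : s₂.arr (.data 0) ((i * (w.length + 1) + j) * σ + a) = target w i j a := by
        rw [hD₂]; exact hT i j hij.1 hij.2 a
      have hle := target_le hij.1 j a
      have hdlt := index_lt hij.1 hij.2 hat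
      have hdlt' : i * (w.length + 1) + j ≤ (i * (w.length + 1) + j) * σ :=
        Nat.le_mul_of_pos_right _ hσ₁
      refine Ends.seq (Ends.assign ?_ (Ends.seq (Ends.output ?_ (Ends.seq (Ends.assign ?_
        (Ends.seq (Ends.assign ?_ (Ends.assign ?_ ?_))))))))
      · simp [Expr.Fits, Expr.val, Op.apply, f2, f5, hx, hi, hj, farr, ha]; omega
      · simp [Expr.Fits, Expr.val, Op.apply, f2, f5, hx, hi, hj, farr, ha]; omega
      · simp [Expr.Fits, Expr.val, Op.apply, f1, f2, f5, hx, hi, hj, farr, ha, hdata]; omega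
      · simp [Expr.Fits, hi]; omega
      · simp [Expr.Fits, Expr.val, Op.apply, f1, f2, f5, hx, hi, hj, farr, ha, hdata]; omega
      · simp [Expr.val, Op.apply, Expr.cost, f1, f2, f5, hx, hb, hi, hj, farr, ha, hdata,
          State.written]
        exact finv.step (by omega) hexta
    · rintro s₃ ⟨f1, f2, f5, farr, pre, hw, hlen, -, hmas⟩ hcl
      refine ⟨⟨by rw [farr]; exact hsame.1, fun k => by rw [farr]; exact hsame.2 k⟩, ?_,
        pre, hmas rfl, fun v hv => ?_, hw⟩
      · have := Nat.mul_le_mul_right 48 (show m + 1 ≤ w.length + 1 by omega)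
        simp only [Expr.cost] at hcl gcl
        omega
      · rw [hlen]; exact (hmax v hv).1

end Longest

/-! ### Enumeration -/

section Enumerate

variable {σ : ℕ}

/-- One step of a depth-first search. Register `3` holds the depth `e` of the current node, which is
`(i, j)` with `i` and `j` in the cells `e` and `e - 1` of the array `work 0`; the cells `1, …, e - 1`
of `work 1` hold the letters on the path to this node, and cell `e` the next letter to be tried. -/
def searchStep : Cmd :=
  .assign 4 (.read (.work 1) (.reg 3)) ;;
  .cond (.reg 4 <ₑ .reg 1)
    (.store (.work 1) (.reg 3) (.reg 4 +ₑ .const 1) ;;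
      .assign 5 (.read (.data 0) ((.read (.work 0) (.reg 3) *ₑ .reg 2 +ₑ
        .read (.work 0) (.reg 3 -ₑ .const 1)) *ₑ .reg 1 +ₑ .reg 4)) ;;
      .cond (.reg 5)
        (.cond (.reg 5 <ₑ .reg 2)
          (.assign 3 (.reg 3 +ₑ .const 1) ;; .store (.work 0) (.reg 3) (.reg 5) ;;
            .store (.work 1) (.reg 3) (.const 0))
          (forLoop 6 3 (.output (.read (.work 1) (.reg 6 +ₑ .const 1))) ;; .output (.const 0)))
        .skip)
    (.assign 3 (.reg 3 -ₑ .const 1))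

def search : Cmd := .loop (.reg 3) searchStep

def enumerateCmd : Cmd :=
  setup ;; .store (.work 0) (.const 0) (.const 0) ;; .store (.work 0) (.const 1) (.const 0) ;;
  .store (.work 1) (.const 1) (.const 0) ;; .assign 3 (.const 1) ;; search

/-- If the search halts when started in `s'`, then it does so when started in `s`, with the same
final state. -/
def Reach (W : ℕ) (s s' : State) : Prop := ∀ s'', Exec W search s' s'' → Exec W search s s''

theorem Reach.refl (W : ℕ) (s : State) : Reach W s s := fun _ h => h

theorem Reach.trans {W : ℕ} {s s' s'' : State} (h : Reach W s s') (h' : Reach W s' s'') :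
    Reach W s s'' := fun _ h'' => h _ (h' _ h'')

theorem Reach.of_exec {W : ℕ} {s s' : State} (h0 : s.reg 3 ≠ 0) (hW : s.reg 3 < W)
    (h : Exec W searchStep (s.tick 2) s') : Reach W s s' := fun _ h' =>
  .loop_true _ _ _ _ _ (s.reg 3) (by simp [Expr.eval, word, hW]) h0 h h'

/-- The times at which an end mark was written. -/
def marks (s : State) : List ℕ := (s.out.filter fun p => p.2 = 0).map Prod.fst

/-- Up to now the delay has been at most `d`, and the last end mark (or the start) is at most `x`
time units ago. -/
def Late (d x : ℕ) (s : State) : Prop :=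
  List.IsChain (fun t t' => t' ≤ t + d) (0 :: marks s) ∧
    ∃ t ∈ (0 :: marks s).getLast?, s.clock ≤ t + x

theorem Late.mono {d x y δ : ℕ} {s s' : State} (h : Late d x s) (hm : marks s' = marks s)
    (hc : s'.clock ≤ s.clock + δ) (hxy : x + δ ≤ y) : Late d y s' := by
  obtain ⟨h1, t, h2, h3⟩ := h
  rw [Late, hm]
  exact ⟨h1, t, h2, by omega⟩

/-- The new bound `y` is arbitrary because the mark is written at the very end of the step: no time
has passed since. -/
theorem Late.mark {d x y δ : ℕ} {s s' : State} (h : Late d x s)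
    (hm : marks s' = marks s ++ [s'.clock]) (hc : s'.clock ≤ s.clock + δ) (hx : x + δ ≤ d) :
    Late d y s' := by
  obtain ⟨h1, t, h2, h3⟩ := h
  rw [Late, hm, ← List.cons_append]
  refine ⟨List.isChain_append.2 ⟨h1, by simp, ?_⟩, s'.clock, List.getLast?_concat, by omega⟩
  rintro t' ht' y hy
  simp only [List.head?_cons, Option.mem_def, Option.some.injEq] at hy h2 ht'
  rw [h2] at ht'
  simp only [Option.some.injEq] at ht'
  omega

theorem Late.isChain {d x : ℕ} {s : State} (h : Late d x s) (hx : x ≤ d) :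
    List.IsChain (fun t t' => t' ≤ t + d) (0 :: marks s ++ [s.clock]) := by
  obtain ⟨h1, t, h2, h3⟩ := h
  refine List.isChain_append.2 ⟨h1, by simp, ?_⟩
  rintro t' ht' y hy
  simp only [List.head?_cons, Option.mem_def, Option.some.injEq] at hy h2 ht'
  rw [h2] at ht'
  simp only [Option.some.injEq] at ht'
  omega

/-- The search has come along the path with label `pre` to the node `(i, j)`, and the next letter
to be tried is `a`. -/
structure AtNode (w : List (Fin σ)) (D : ℕ → ℕ → ℕ) (pre : List (Fin σ)) (i j a : ℕ)
    (s : State) : Prop where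
  env : Env w D s
  depth : s.reg 3 = pre.length + 1
  pos : s.arr (.work 0) (pre.length + 1) = i
  prev : s.arr (.work 0) pre.length = j
  letters : ∀ x (h : x < pre.length), s.arr (.work 1) (x + 1) = (pre[x] : Fin σ).val + 1
  cur : s.arr (.work 1) (pre.length + 1) = a

/-- The part of the stack below the current node at depth `e` is the same in `s` and `s'`. -/
def SameStack (e : ℕ) (s s' : State) : Prop := ∀ x < e, s'.arr (.work 0) x = s.arr (.work 0) x

/-- A bound for the time of a step of the search. -/
def stepTime (n : ℕ) : ℕ := 60 * (n + 1)

/-! ### Single steps of the depth-first search. -/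

section Steps

variable {W : ℕ} {w : List (Fin σ)} {D : ℕ → ℕ → ℕ} {pre : List (Fin σ)} {i j : ℕ} {s : State}

/-- Backtracking only lowers the depth; the cells of the parent node have stayed in place on the
stack. -/
theorem exists_reach_pop (hσ : σ ≤ w.length) (hW : (w.length + 1) ^ 3 + 10 < W)
    (hpre : pre.length ≤ w.length) (h : AtNode w D pre i j σ s) :
    ∃ s', Reach W s s' ∧ Env w D s' ∧ s'.reg 3 = pre.length ∧ s'.arr = s.arr ∧ s'.out = s.out ∧
      s'.clock ≤ s.clock + stepTime w.length := by
  have hW' : w.length + 3 < W := by nlinarith [Nat.zero_le (w.length ^ 3)]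
  obtain ⟨⟨h0, h1, h2, hin, hD⟩, h3, -, -, -, hcur⟩ := h
  suffices h : Ends W searchStep (s.tick 2) fun s' => Env w D s' ∧ s'.reg 3 = pre.length ∧
      s'.arr = s.arr ∧ s'.out = s.out ∧ s'.clock ≤ s.clock + stepTime w.length by
    obtain ⟨s', h4, h5⟩ := h
    exact ⟨s', Reach.of_exec (by omega) (by omega) h4, h5⟩
  refine Ends.seq (Ends.assign ?_ (Ends.cond ?_ (fun hc => ?_) (fun hc => Ends.assign ?_ ?_)))
  · simp [Expr.Fits, Expr.val, State.tick, h3, hcur]; omega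
  · simp [Expr.Fits, Expr.val, Op.apply, State.tick, h1, h3, hcur]; omega
  · simp [Expr.val, Op.apply, State.tick, h1, h3, hcur] at hc
  · simp [Expr.Fits, Expr.val, Op.apply, State.tick, h3]; omega
  · refine ⟨⟨?_, ?_, ?_, ?_, ?_⟩, ?_, ?_, ?_, ?_⟩ <;>
      simp [State.tick, Expr.val, Op.apply, Expr.cost, h0, h1, h2, h3, hin, hD, stepTime]
    omega

/-- The step at a letter. -/
theorem exists_reach_step (hσ : σ ≤ w.length) (hW : (w.length + 1) ^ 3 + 10 < W)
    (hT : IsTable w (D 0)) (hp : IsPair w.length i j) (hpre : pre.length ≤ i) (a : Fin σ)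
    (h : AtNode w D pre i j a s) :
    ∃ s', Reach W s s' ∧ s'.clock ≤ s.clock + stepTime w.length ∧
      SameStack (pre.length + 1) s s' ∧
      (target w i j a = 0 → AtNode w D pre i j (a + 1) s' ∧ s'.out = s.out) ∧
      (target w i j a ≠ 0 → target w i j a ≤ w.length →
        AtNode w D (pre ++ [a]) (target w i j a) i 0 s' ∧ s'.out = s.out) ∧
      (target w i j a = w.length + 1 → AtNode w D pre i j (a + 1) s' ∧
        s'.written = s.written ++ (code (pre ++ [a]) ++ [0]) ∧
        marks s' = marks s ++ [s'.clock]) := by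
  have hW' : w.length + 3 < W := by nlinarith [Nat.zero_le (w.length ^ 3)]
  obtain ⟨⟨h0, h1, h2, hin, hD⟩, h3, hpos, hprev, hlet, hcur⟩ := h
  have ha := a.2
  have hij := hp.le
  have hsize := table_size_le hσ
  have htab := hT i j hij.1 hij.2 a
  have hle := target_le hij.1 j a
  have hlt := index_lt hij.1 hij.2 ha
  have hb2 : i * (w.length + 1) + j ≤ (i * (w.length + 1) + j) * σ :=
    Nat.le_mul_of_pos_right _ a.pos
  generalize hk : target w i j a = k at *
  suffices h : Ends W searchStep (s.tick 2) fun s' =>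
      s'.clock ≤ s.clock + stepTime w.length ∧ SameStack (pre.length + 1) s s' ∧
      (k = 0 → AtNode w D pre i j (a + 1) s' ∧ s'.out = s.out) ∧
      (k ≠ 0 → k ≤ w.length → AtNode w D (pre ++ [a]) k i 0 s' ∧ s'.out = s.out) ∧
      (k = w.length + 1 → AtNode w D pre i j (a + 1) s' ∧
        s'.written = s.written ++ (code (pre ++ [a]) ++ [0]) ∧
        marks s' = marks s ++ [s'.clock]) by
    obtain ⟨s', h4, h5⟩ := h
    exact ⟨s', Reach.of_exec (by omega) (by omega) h4, h5⟩
  refine Ends.seq (Ends.assign ?_ (Ends.cond ?_ (fun hc => ?_) (fun hc => ?_)))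
  · simp [Expr.Fits, Expr.val, State.tick, h3, hcur]; omega
  · simp [Expr.Fits, Expr.val, Op.apply, State.tick, h1, h3, hcur]; omega
  · refine Ends.seq (Ends.store ?_ ?_ (Ends.seq (Ends.assign ?_ ?_)))
    · simp [Expr.Fits, State.tick, h3]; omega
    · simp [Expr.Fits, Expr.val, Op.apply, State.tick, h3, hcur]; omega
    · simp [Expr.Fits, Expr.val, Op.apply, State.tick, h1, h2, h3, hcur, hpos, hprev, hD, htab]
      omega
    generalize hs₁ : State.mk _ _ _ _ = s₁
    have r0 : s₁.reg 0 = w.length := by subst hs₁; simp [State.tick, h0]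
    have r1 : s₁.reg 1 = σ := by subst hs₁; simp [State.tick, h1]
    have r2 : s₁.reg 2 = w.length + 1 := by subst hs₁; simp [State.tick, h2]
    have r3 : s₁.reg 3 = pre.length + 1 := by subst hs₁; simp [State.tick, h3]
    have r5 : s₁.reg 5 = k := by
      subst hs₁
      simp [Expr.val, Op.apply, State.tick, h1, h2, h3, hcur, hpos, hprev, hD, htab]
    have rin : s₁.arr .input = inputArray w := by subst hs₁; simp [State.tick, hin]
    have rD : ∀ k, s₁.arr (.data k) = D k := by subst hs₁; simp [State.tick, hD]
    have rP : s₁.arr (.work 0) = s.arr (.work 0) := by subst hs₁; simp [State.tick]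
    have rL : ∀ x, x ≠ pre.length + 1 → s₁.arr (.work 1) x = s.arr (.work 1) x := by
      intro x hx; subst hs₁; simp [Expr.val, State.tick, h3, hx]
    have rL' : s₁.arr (.work 1) (pre.length + 1) = a + 1 := by
      subst hs₁; simp [Expr.val, Op.apply, State.tick, h3, hcur]
    have rout : s₁.out = s.out := by subst hs₁; rfl
    have rcl : s₁.clock ≤ s.clock + 29 := by subst hs₁; simp [Expr.cost, State.tick]
    -- The value `a + 1` is both the next letter to be tried and the code of `a`; so the stack of
    -- letters can be written out as it is.
    have rlet : ∀ x (h : x < (pre ++ [a]).length),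
        s₁.arr (.work 1) (x + 1) = ((pre ++ [a])[x] : Fin σ).val + 1 := by
      intro x hx
      rw [List.length_append, List.length_singleton] at hx
      rcases Nat.lt_succ_iff_lt_or_eq.1 hx with hx' | rfl
      · rw [rL _ (by omega), hlet x hx', List.getElem_append_left hx']
      · rw [rL']; simp
    clear hs₁
    have hnode : ∀ s', s'.reg 0 = w.length → s'.reg 1 = σ → s'.reg 2 = w.length + 1 →
        s'.reg 3 = pre.length + 1 → s'.arr = s₁.arr → AtNode w D pre i j (a + 1) s' := by
      intro s' e0 e1 e2 e3 earr
      refine ⟨⟨e0, e1, e2, by rw [earr, rin], fun k => by rw [earr, rD]⟩, e3, by rw [earr, rP, hpos],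
        by rw [earr, rP, hprev], fun x hx => ?_, by rw [earr, rL']⟩
      rw [earr, rL _ (by omega), hlet x hx]
    refine Ends.cond ?_ (fun hc => Ends.cond ?_ (fun hc' => ?_) (fun hc' => ?_)) (fun hc => ?_)
    · simp [Expr.Fits, r5]; omega
    · simp [Expr.Fits, Expr.val, Op.apply, State.tick, r2, r5]; split_ifs <;> omega
    · have hc : k ≠ 0 := by simpa [Expr.val, r5] using hc
      have hc' : k ≤ w.length := by
        simp [Expr.val, Op.apply, State.tick, r2, r5] at hc'; omega
      refine Ends.seq (Ends.assign ?_ (Ends.seq (Ends.store ?_ ?_ (Ends.store ?_ ?_ ?_))))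
      · simp [Expr.Fits, Expr.val, Op.apply, State.tick, r3]; omega
      · simp [Expr.Fits, Expr.val, Op.apply, State.tick, r3]; omega
      · simp [Expr.Fits, State.tick, r5]; omega
      · simp [Expr.Fits, Expr.val, Op.apply, State.tick, r3]; omega
      · simp [Expr.Fits]; omega
      · refine ⟨?_, ?_, fun h => absurd h hc, fun _ _ => ⟨⟨⟨?_, ?_, ?_, ?_, ?_⟩, ?_, ?_, ?_, ?_, ?_⟩,
          rout⟩, fun h => by omega⟩
        · simp [State.tick, Expr.cost, stepTime]; omega
        · intro x hx
          have : x ≠ pre.length + 1 + 1 := by omega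
          simp [State.tick, Expr.val, Op.apply, r3, rP, this]
        · simp [State.tick, r0]
        · simp [State.tick, r1]
        · simp [State.tick, r2]
        · simp [State.tick, rin]
        · simp [State.tick, rD]
        · simp [State.tick, Expr.val, Op.apply, r3]
        · simp [State.tick, Expr.val, Op.apply, r3, r5]
        · simp [State.tick, Expr.val, Op.apply, r3, rP, hpos]
        · intro x hx
          have hx' : x ≠ pre.length + 1 := by
            rw [List.length_append, List.length_singleton] at hx; omega
          rw [← rlet x hx]
          simp [State.tick, Expr.val, Op.apply, r3, hx']
        · simp [State.tick, Expr.val, Op.apply, r3]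
    · have hc' : k = w.length + 1 := by
        simp [Expr.val, Op.apply, State.tick, r2, r5] at hc'; omega
      -- Writing a whole word, of at most `n + 1` letters, is what makes `stepTime` linear in `n`
      -- rather than constant.
      refine Ends.seq (Ends.forLoop
        (fun t s' => s'.reg 0 = w.length ∧ s'.reg 1 = σ ∧ s'.reg 2 = w.length + 1 ∧
          s'.reg 3 = pre.length + 1 ∧ s'.arr = s₁.arr ∧
          s'.written = s.written ++ code ((pre ++ [a]).take t) ∧ marks s' = marks s)
        (pre.length + 1) 5 ?_ (by simp) (by omega) (by omega) (fun _ _ _ h => h) ?_ ?_ ?_)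
      · simp [State.tick, r3]
      · simp [State.tick, r0, r1, r2, r3, rout, State.written, marks, code_eq_map]
      · rintro t s' ht hx - ⟨e0, e1, e2, e3, earr, ew, em⟩
        have ht' : t < (pre ++ [a]).length := by simp; omega
        have hr := rlet t ht'
        have hv := ((pre ++ [a])[t]).2
        refine Ends.output ?_ ⟨hx, e3, ?_, ?_⟩
        · simp [Expr.Fits, Expr.val, Op.apply, hx, earr, hr]; omega
        · simp [Expr.cost]
        · simp only [State.written, marks] at ew em
          have hcode : code ((pre ++ [a]).take (t + 1)) =
              code ((pre ++ [a]).take t) ++ [(pre ++ [a])[t].val + 1] := by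
            rw [List.take_succ_eq_append_getElem ht', code_eq_map, code_eq_map, List.map_append]
            rfl
          rw [hcode]
          simp [Expr.val, Op.apply, hx, e0, e1, e2, e3, earr, hr, State.written, marks, ew, em]
      · rintro s' ⟨e0, e1, e2, e3, earr, ew, em⟩ ecl
        rw [List.take_of_length_le (by simp)] at ew
        refine Ends.output ?_ ⟨?_, ?_, fun h => by omega, fun _ h => by omega, fun _ => ⟨?_, ?_, ?_⟩⟩
        · simp [Expr.Fits]; omega
        · simp [State.tick, Expr.cost] at ecl
          simp [Expr.cost, stepTime]; omega
        · intro x _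
          simp [earr, rP]
        · exact hnode _ e0 e1 e2 e3 earr
        · simp only [State.written] at ew
          simp [State.written, ew, Expr.val]
        · simp only [marks] at em
          simp [marks, em, Expr.val]
    · have hc : k = 0 := by simpa [Expr.val, r5] using hc
      refine Ends.skip ⟨?_, ?_, fun _ => ⟨?_, rout⟩, fun h => absurd hc h, fun h => by omega⟩
      · simp [State.tick, Expr.cost, stepTime]; omega
      · intro x _
        simp [State.tick, rP]
      · exact hnode _ r0 r1 r2 r3 rfl
  · simp [Expr.val, Op.apply, State.tick, h1, h3, hcur] at hc

end Steps

end Enumerate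

/-! ### The output below a node, and the delay. -/

section Visit

variable {σ : ℕ}

/-- The output that belongs to the continuations `L` of the word `pre`. -/
def listing (pre : List (Fin σ)) (L : List (List (Fin σ))) : List ℕ :=
  L.flatMap fun v => code (pre ++ v) ++ [0]

theorem listing_append (pre : List (Fin σ)) (L M : List (List (Fin σ))) :
    listing pre (L ++ M) = listing pre L ++ listing pre M := List.flatMap_append

theorem listing_map_cons (pre : List (Fin σ)) (a : Fin σ) (L : List (List (Fin σ))) :
    listing pre (L.map (a :: ·)) = listing (pre ++ [a]) L := by
  simp [listing, List.flatMap_map]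

theorem SameStack.refl (e : ℕ) (s : State) : SameStack e s s := fun _ _ => rfl

theorem SameStack.trans {e e' : ℕ} {s s' s'' : State} (h : SameStack e s s')
    (h' : SameStack e' s' s'') (he : e ≤ e') : SameStack e s s'' := fun x hx => by
  rw [h' x (by omega), h x hx]

/-- The time that the search may spend at a node. -/
def nodeTime (n σ : ℕ) : ℕ := stepTime n * (σ + 3)

/-- A bound for the delay of the enumeration. -/
def delay (n σ : ℕ) : ℕ := (2 * n + 4) * nodeTime n σ

variable {W : ℕ} {w : List (Fin σ)} {D : ℕ → ℕ → ℕ}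

/-- The search started at `(i, j)` lists the labels of the paths to the sink. The bounds on the
time since the last end mark grow on the way down and are small on the way up. -/
def Visits (W : ℕ) (w : List (Fin σ)) (D : ℕ → ℕ → ℕ) (pre : List (Fin σ)) (i j : ℕ) : Prop :=
  ∀ s, AtNode w D pre i j 0 s →
    Late (delay w.length σ) ((w.length + 3 + pre.length) * nodeTime w.length σ) s →
    ∃ s' L, Reach W s s' ∧ AtNode w D pre i j σ s' ∧ SameStack (pre.length + 1) s s' ∧
      L.Nodup ∧ (∀ v, v ∈ L ↔ Good w i j v) ∧ s'.written = s.written ++ listing pre L ∧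
      Late (delay w.length σ) ((w.length + 1 - pre.length) * nodeTime w.length σ) s'

/-- One letter, together with everything that is found below it. -/
theorem exists_reach_letter (hσ : σ ≤ w.length) (hW : (w.length + 1) ^ 3 + 10 < W)
    (hT : IsTable w (D 0)) {pre : List (Fin σ)} {i j : ℕ} (hp : IsPair w.length i j)
    (hpre : pre.length ≤ i) (a : Fin σ)
    (ih : target w i j a ≠ 0 → target w i j a ≤ w.length →
      Visits W w D (pre ++ [a]) (target w i j a) i)
    {s : State} (h : AtNode w D pre i j a s) {x : ℕ} (hx : Late (delay w.length σ) x s)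
    (hx' : x + stepTime w.length ≤ (w.length + 4 + pre.length) * nodeTime w.length σ) :
    ∃ s' M, Reach W s s' ∧ AtNode w D pre i j (a + 1) s' ∧ SameStack (pre.length + 1) s s' ∧
      M.Nodup ∧ (∀ v, v ∈ M ↔ Good w i j v ∧ v.head? = some a) ∧
      s'.written = s.written ++ listing pre M ∧
      ((target w i j a = 0 ∧ Late (delay w.length σ) (x + stepTime w.length) s') ∨
        Late (delay w.length σ)
          ((w.length - pre.length) * nodeTime w.length σ + stepTime w.length) s') := by
  have hi := hp.le.1
  have hle := target_le hi j a
  obtain ⟨s₁, hr, hcl, hst, hzero, hpush, hsink⟩ := exists_reach_step hσ hW hT hp hpre a h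
  by_cases h0 : target w i j a = 0
  · obtain ⟨hat, hout⟩ := hzero h0
    refine ⟨s₁, [], hr, hat, hst, List.nodup_nil, fun v => ?_, by simp [State.written, hout, listing],
      Or.inl ⟨h0, hx.mono (by simp [marks, hout]) hcl le_rfl⟩⟩
    simp only [List.not_mem_nil, false_iff]
    rintro ⟨hv, hh⟩
    obtain ⟨u, rfl⟩ : ∃ u, v = a :: u := by
      cases v with
      | nil => simp at hh
      | cons b u => exact ⟨u, by simpa using hh⟩
    rw [good_cons_iff hp, h0] at hv
    simp at hv
  by_cases hk : target w i j a ≤ w.length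
  · obtain ⟨hat, hout⟩ := hpush h0 hk
    have hlt := target_bounds h0
    have hlen : (pre ++ [a]).length = pre.length + 1 := by simp
    obtain ⟨s₂, L, hr₂, hat₂, hst₂, hnd, hmem, hwr, hlate⟩ := ih h0 hk s₁ hat
      (hx.mono (by simp [marks, hout]) hcl (by rw [hlen]; convert hx' using 2; omega))
    obtain ⟨s₃, hr₃, henv, h3, harr, hout₃, hcl₃⟩ :=
      exists_reach_pop hσ hW (by rw [hlen]; omega) hat₂
    refine ⟨s₃, L.map (a :: ·), hr.trans (hr₂.trans hr₃), ?_, ?_, ?_, fun v => ?_, ?_, Or.inr ?_⟩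
    · refine ⟨henv, by rw [h3, hlen], ?_, ?_, fun y hy => ?_, ?_⟩
      · rw [harr, ← hlen, hat₂.prev]
      · rw [harr, hst₂ _ (by omega), hst _ (by omega), h.prev]
      · rw [harr, hat₂.letters y (by omega), List.getElem_append_left hy]
      · rw [harr, hat₂.letters pre.length (by omega)]; simp
    · refine (hst.trans hst₂ (by omega)).trans (fun y _ => by rw [harr]) le_rfl
    · exact hnd.map (List.cons_injective)
    · rw [List.mem_map]
      constructor
      · rintro ⟨u, hu, rfl⟩
        exact ⟨(good_cons_iff hp).2 (Or.inr ⟨h0, hk, (hmem u).1 hu⟩), rfl⟩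
      · rintro ⟨hv, hh⟩
        cases v with
        | nil => simp at hh
        | cons b u =>
          obtain rfl : b = a := by simpa using hh
          rcases (good_cons_iff hp).1 hv with ⟨h4, -⟩ | ⟨-, -, h4⟩
          · omega
          · exact ⟨u, (hmem u).2 h4, rfl⟩
    · rw [listing_map_cons, State.written, hout₃, ← State.written, hwr, State.written, hout,
        ← State.written]
    · refine hlate.mono (by simp [marks, hout₃]) hcl₃ ?_
      rw [hlen, Nat.add_sub_add_right]
  · obtain ⟨hat, hwr, hm⟩ := hsink (by omega)
    refine ⟨s₁, [[a]], hr, hat, hst, List.nodup_singleton _, fun v => ?_, by simp [hwr, listing],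
      -- The time budget at a mark fits into `delay`: as `pre.length ≤ n`, the coefficient `n + 4 +
      -- pre.length` is at most `2 * n + 4`.
      Or.inr (hx.mark hm hcl (hx'.trans (Nat.mul_le_mul_right _ (by omega))))⟩
    rw [List.mem_singleton]
    constructor
    · rintro rfl
      exact ⟨(good_cons_iff hp).2 (Or.inl ⟨by omega, rfl⟩), rfl⟩
    · rintro ⟨hv, hh⟩
      cases v with
      | nil => simp at hh
      | cons b u =>
        obtain rfl : b = a := by simpa using hh
        rcases (good_cons_iff hp).1 hv with ⟨-, rfl⟩ | ⟨-, h4, -⟩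
        · rfl
        · omega

/-- Induction on `n - i`, which also gives termination of the search. Each level of the descent adds
at most one `nodeTime` to the time since the last mark. Since the subtree below a node contains a
mark, the time on leaving the node is measured from that mark and depends only on the levels climbed
since then. -/
theorem visits (hσ₁ : 1 ≤ σ) (hσ : σ ≤ w.length) (hW : (w.length + 1) ^ 3 + 10 < W)
    (hT : IsTable w (D 0)) {pre : List (Fin σ)} {i j : ℕ} (hp : IsPair w.length i j)
    (hpre : pre.length ≤ i) : Visits W w D pre i j := by
  induction hm : w.length - i using Nat.strong_induction_on generalizing pre i j with
  | _ m ih =>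
    intro s hs hlate
    have hi := hp.le.1
    set c := stepTime w.length with hc
    set d := delay w.length σ with hd
    have hqc : nodeTime w.length σ = c * σ + 3 * c := by rw [nodeTime, ← hc]; ring
    have e1 : (w.length + 4 + pre.length) * nodeTime w.length σ =
        (w.length + 3 + pre.length) * nodeTime w.length σ + nodeTime w.length σ := by ring
    have e2 : (w.length + 1 - pre.length) * nodeTime w.length σ =
        (w.length - pre.length) * nodeTime w.length σ + nodeTime w.length σ := by
      rw [show w.length + 1 - pre.length = w.length - pre.length + 1 by omega, Nat.succ_mul]
    have e3 : (w.length - pre.length) * nodeTime w.length σ ≤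
        (w.length + 3 + pre.length) * nodeTime w.length σ :=
      Nat.mul_le_mul_right _ (by omega)
    -- Here `a` letters have been tried. Either none has had an edge and the time inherited from
    -- above keeps running, or a mark has been written below this node and the small bound holds.
    have main : ∀ a ≤ σ, ∃ s' L, Reach W s s' ∧ AtNode w D pre i j a s' ∧
        SameStack (pre.length + 1) s s' ∧ L.Nodup ∧
        (∀ v, v ∈ L ↔ Good w i j v ∧ ∃ b : Fin σ, b.val < a ∧ v.head? = some b) ∧
        s'.written = s.written ++ listing pre L ∧
        (((∀ b : Fin σ, b.val < a → target w i j b = 0) ∧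
            Late d ((w.length + 3 + pre.length) * nodeTime w.length σ + c * a) s') ∨
          Late d ((w.length - pre.length) * nodeTime w.length σ + (c * a + c)) s') := by
      intro a
      induction a with
      | zero =>
        refine fun _ => ⟨s, [], Reach.refl _ _, hs, SameStack.refl _ _, List.nodup_nil, by simp,
          by simp [listing], Or.inl ⟨by simp, by simpa using hlate⟩⟩
      | succ a iha =>
        intro ha
        obtain ⟨s₁, L, hr, hat, hst, hnd, hmem, hwr, htime⟩ := iha (by omega)
        have hca : c * (a + 1) ≤ c * σ := Nat.mul_le_mul_left _ ha
        rw [Nat.mul_succ] at hca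
        have hchild : target w i j ⟨a, ha⟩ ≠ 0 → target w i j ⟨a, ha⟩ ≤ w.length →
            Visits W w D (pre ++ [⟨a, ha⟩]) (target w i j ⟨a, ha⟩) i := by
          intro h0 hk
          have := target_bounds h0
          exact ih _ (by omega) (IsPair.target h0 hk) (by simp; omega) rfl
        have hcomb : ∀ s₂ M, Reach W s₁ s₂ → AtNode w D pre i j (a + 1) s₂ →
            SameStack (pre.length + 1) s₁ s₂ → M.Nodup →
            (∀ v, v ∈ M ↔ Good w i j v ∧ v.head? = some ⟨a, ha⟩) →
            s₂.written = s₁.written ++ listing pre M →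
            (((∀ b : Fin σ, b.val < a + 1 → target w i j b = 0) ∧
                Late d ((w.length + 3 + pre.length) * nodeTime w.length σ + c * (a + 1)) s₂) ∨
              Late d ((w.length - pre.length) * nodeTime w.length σ + (c * (a + 1) + c)) s₂) →
            ∃ s' L, Reach W s s' ∧ AtNode w D pre i j (a + 1) s' ∧
              SameStack (pre.length + 1) s s' ∧ L.Nodup ∧
              (∀ v, v ∈ L ↔ Good w i j v ∧ ∃ b : Fin σ, b.val < a + 1 ∧ v.head? = some b) ∧
              s'.written = s.written ++ listing pre L ∧
              (((∀ b : Fin σ, b.val < a + 1 → target w i j b = 0) ∧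
                  Late d ((w.length + 3 + pre.length) * nodeTime w.length σ + c * (a + 1)) s') ∨
                Late d ((w.length - pre.length) * nodeTime w.length σ + (c * (a + 1) + c)) s') := by
          intro s₂ M hr₂ hat₂ hst₂ hnd₂ hmem₂ hwr₂ htime₂
          refine ⟨s₂, L ++ M, hr.trans hr₂, hat₂, hst.trans hst₂ le_rfl, ?_, fun v => ?_, ?_, htime₂⟩
          -- The two lists are disjoint because their words differ in the first letter.
          · refine hnd.append hnd₂ fun v h1 h2 => ?_
            obtain ⟨-, b, hb, hb'⟩ := (hmem v).1 h1
            have := ((hmem₂ v).1 h2).2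
            rw [hb'] at this
            simp only [Option.some.injEq] at this
            rw [this] at hb
            exact lt_irrefl _ hb
          · rw [List.mem_append, hmem, hmem₂]
            constructor
            · rintro (⟨h1, b, hb, hb'⟩ | ⟨h1, h2⟩)
              · exact ⟨h1, b, by omega, hb'⟩
              · exact ⟨h1, _, Nat.lt_succ_self a, h2⟩
            · rintro ⟨h1, b, hb, hb'⟩
              rcases Nat.lt_succ_iff_lt_or_eq.1 hb with h2 | h2
              · exact Or.inl ⟨h1, b, h2, hb'⟩
              · obtain rfl : b = ⟨a, ha⟩ := Fin.ext h2
                exact Or.inr ⟨h1, hb'⟩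
          · rw [hwr₂, hwr, listing_append, List.append_assoc]
        rw [Nat.mul_succ]
        rw [Nat.mul_succ] at hcomb
        rcases htime with ⟨hnone, ht⟩ | ht
        · obtain ⟨s₂, M, hr₂, hat₂, hst₂, hnd₂, hmem₂, hwr₂, htime₂⟩ :=
            exists_reach_letter hσ hW hT hp hpre ⟨a, ha⟩ hchild hat ht (by omega)
          refine hcomb s₂ M hr₂ hat₂ hst₂ hnd₂ hmem₂ hwr₂ ?_
          rcases htime₂ with ⟨h0, ht₂⟩ | ht₂
          · refine Or.inl ⟨fun b hb => ?_, ht₂.mono (δ := 0) rfl le_rfl (by omega)⟩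
            rcases Nat.lt_succ_iff_lt_or_eq.1 hb with h2 | h2
            · exact hnone b h2
            · obtain rfl : b = ⟨a, ha⟩ := Fin.ext h2
              exact h0
          · exact Or.inr (ht₂.mono (δ := 0) rfl le_rfl (by omega))
        · obtain ⟨s₂, M, hr₂, hat₂, hst₂, hnd₂, hmem₂, hwr₂, htime₂⟩ :=
            exists_reach_letter hσ hW hT hp hpre ⟨a, ha⟩ hchild hat ht (by omega)
          refine hcomb s₂ M hr₂ hat₂ hst₂ hnd₂ hmem₂ hwr₂ (Or.inr ?_)
          rcases htime₂ with ⟨h0, ht₂⟩ | ht₂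
          · exact ht₂.mono (δ := 0) rfl le_rfl (by omega)
          · exact ht₂.mono (δ := 0) rfl le_rfl (by omega)
    obtain ⟨s', L, hr, hat, hst, hnd, hmem, hwr, htime⟩ := main σ le_rfl
    refine ⟨s', L, hr, hat, hst, hnd, fun v => ?_, hwr, ?_⟩
    · rw [hmem]
      refine ⟨fun h => h.1, fun h => ⟨h, ?_⟩⟩
      cases v with
      | nil => exact absurd h not_good_nil
      | cons b u => exact ⟨b, b.2, rfl⟩
    · rcases htime with ⟨hnone, -⟩ | ht
      -- There are no dead ends, so the large bound cannot persist through all letters.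
      · obtain ⟨b, hb⟩ := exists_target_ne_zero hσ₁ hp
        exact absurd (hnone b b.2) hb
      · exact ht.mono (δ := 0) rfl le_rfl (by omega)

theorem answers_enumerateCmd (hσ₁ : 1 ≤ σ) (hσ : σ ≤ w.length)
    (hW : (w.length + 1) ^ 3 + 10 < W) {s : State} (hin : s.arr .input = inputArray w)
    (hT : IsTable w (s.arr (.data 0))) (hclock : s.clock = 0) (hout : s.out = []) :
    Answers W enumerateCmd s fun s' => s'.Enumerates {v | IsMAS w v} (delay w.length σ) := by
  have hW' : w.length + 3 < W := by nlinarith [Nat.zero_le (w.length ^ 3)]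
  have hq : 60 ≤ nodeTime w.length σ := by
    unfold nodeTime stepTime; nlinarith [Nat.zero_le (w.length * σ)]
  have hcq : stepTime w.length ≤ nodeTime w.length σ := Nat.le_mul_of_pos_right _ (by omega)
  refine Ends.seq (Ends.setup hσ (by omega) hin fun s₀ henv harr hout' hclock' => ?_)
  obtain ⟨h0, h1, h2, hin₀, hD₀⟩ := henv
  refine Ends.seq (Ends.store ?_ ?_ (Ends.seq (Ends.store ?_ ?_ (Ends.seq (Ends.store ?_ ?_
    (Ends.seq (Ends.assign ?_ ?_)))))))
  iterate 7 · simp [Expr.Fits]; omega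
  -- The source `(0, 0)` has depth `1`: its coordinates are in the cells `1` and `0` of `work 0`.
  generalize hs₁ : State.mk _ _ _ _ = s₁
  have hat : AtNode w (fun k => s.arr (.data k)) [] 0 0 0 s₁ := by
    subst hs₁
    refine ⟨⟨?_, ?_, ?_, ?_, ?_⟩, ?_, ?_, ?_, ?_, ?_⟩ <;>
      simp [Expr.val, h0, h1, h2, hin₀, hD₀]
  have hout₁ : s₁.out = [] := by subst hs₁; simp [hout', hout]
  have hcl₁ : s₁.clock ≤ 30 := by subst hs₁; simp [Expr.cost, hclock', hclock]
  have hlate : Late (delay w.length σ)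
      ((w.length + 3 + ([] : List (Fin σ)).length) * nodeTime w.length σ) s₁ := by
    refine ⟨by simp [marks, hout₁], 0, by simp [marks, hout₁], ?_⟩
    have := Nat.le_mul_of_pos_left (nodeTime w.length σ)
      (show 0 < w.length + 3 + ([] : List (Fin σ)).length by omega)
    omega
  obtain ⟨s₂, L, hr, hat₂, -, hnd, hmem, hwr, hlate₂⟩ :=
    visits hσ₁ hσ hW hT (isPair_zero _) (le_refl 0) s₁ hat hlate
  obtain ⟨s₃, hr₃, henv₃, h3, harr₃, hout₃, hcl₃⟩ := exists_reach_pop hσ hW (by simp) hat₂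
  refine ⟨_, hr _ (hr₃ _ (.loop_false _ _ _ ?_)), ⟨?_, ?_⟩, ⟨L, hnd, fun v => ?_, ?_⟩, ?_⟩
  · simp [Expr.eval, word, h3]; omega
  · simp [State.tick, henv₃.input, hin]
  · intro k; simp [State.tick, henv₃.data]
  · rw [hmem, good_zero]; rfl
  · have : s₁.written = [] := by simp [State.written, hout₁]
    rw [this] at hwr
    simp only [State.written, State.tick, hout₃] at hwr ⊢
    simpa [listing] using hwr
  · refine Late.isChain (x := (w.length + 2) * nodeTime w.length σ + 2) (s := s₃.tick _) ?_ ?_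
    · refine (hlate₂.mono (s' := s₃) (by simp [marks, hout₃]) hcl₃ le_rfl).mono (δ := 2)
        (by simp [marks, State.tick]) (by simp [State.tick, Expr.cost]) ?_
      simp only [List.length_nil, Nat.sub_zero]
      have := Nat.succ_mul (w.length + 1) (nodeTime w.length σ)
      simp only [Nat.succ_eq_add_one, Nat.add_assoc, Nat.reduceAdd] at this
      omega
    · rw [delay, show 2 * w.length + 4 = (w.length + 2) + (w.length + 2) by ring,
        Nat.add_mul (w.length + 2)]
      have := Nat.le_mul_of_pos_left (nodeTime w.length σ) (show 0 < w.length + 2 by omega)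
      omega

end Visit

/-! ### One constant for all bounds. -/

theorem mul_pow_le {n c e K : ℕ} (hc : c ≤ K) (he : e ≤ K) :
    c * (n + 1) ^ e ≤ K * (n + 1) ^ K :=
  Nat.mul_le_mul hc (Nat.pow_le_pow_right (Nat.succ_pos n) he)

theorem delay_le {n σ : ℕ} (hσ : σ ≤ n) : delay n σ ≤ 720 * (n + 1) ^ 3 := by
  have h1 : 2 * n + 4 ≤ 4 * (n + 1) := by omega
  have h2 : σ + 3 ≤ 3 * (n + 1) := by omega
  calc delay n σ = (2 * n + 4) * (60 * (n + 1) * (σ + 3)) := rfl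
    _ ≤ 4 * (n + 1) * (60 * (n + 1) * (3 * (n + 1))) :=
      Nat.mul_le_mul h1 (Nat.mul_le_mul_left _ h2)
    _ = 720 * (n + 1) ^ 3 := by ring

theorem State.Enumerates.mono {σ : ℕ} {s : State} {S : Set (List (Fin σ))} {d d' : ℕ}
    (h : s.Enumerates S d) (hd : d ≤ d') : s.Enumerates S d' :=
  ⟨h.1, h.2.imp fun _ _ h => by omega⟩

theorem Answers.mono {W : ℕ} {c : Cmd} {s : State} {P Q : State → Prop} (h : Answers W c s P)
    (hPQ : ∀ s', P s' → Q s') : Answers W c s Q := by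
  obtain ⟨s', h1, h2, h3⟩ := h
  exact ⟨s', h1, h2, hPQ s' h3⟩

end MASRep

open MASRep in
theorem mainTheorem6 :
    ∃ (build check longest ofLength enumerate : Cmd) (K : ℕ),
      ∀ (σ : ℕ) (w : List (Fin σ)), 1 ≤ σ → σ ≤ w.length →
        -- the graph of `w` is acyclic, and its source-to-sink paths correspond to the MAS of `w`
        IsAcyclic w ∧
        Set.BijOn label {p | IsPath w (.pos 0 0) p .sink} {v | IsMAS w v} ∧
        -- for all sufficiently large word sizes, the lower bound being of order `log n`:
        ∀ W : ℕ, K * (w.length + 1) ^ K ≤ W →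
          -- construction of the graph, together with further data structures
          ∃ s₁ : State, Exec W build (initial w) s₁ ∧
            s₁.clock ≤ K * (w.length ^ 2 * σ) ∧
            s₁.arr .input = inputArray w ∧
            StoresGraph w (s₁.arr (.data 0)) ∧
            -- is a given word an MAS?
            (∀ (u : List (Fin σ)) (s : State), IsQueryStart s₁ s → u.length < W →
              s.arr .query = load (u.length :: code u) →
              Answers W check s fun s' =>
                s'.clock ≤ K * (u.length + 1) ∧ s'.Decides (IsMAS w u)) ∧
            -- a longest MAS
            (∀ s : State, IsQueryStart s₁ s →
              Answers W longest s fun s' =>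
                s'.clock ≤ K * (w.length + 1) ^ K ∧
                ∃ v, IsMAS w v ∧ (∀ v', IsMAS w v' → v'.length ≤ v.length) ∧
                  s'.written = code v) ∧
            -- is there an MAS of a given length?
            (∀ (l : ℕ) (s : State), IsQueryStart s₁ s → l < W → s.arr .query = load [l] →
              Answers W ofLength s fun s' =>
                s'.clock ≤ K * (w.length + 1) ^ K ∧
                s'.Decides (∃ v, IsMAS w v ∧ v.length = l)) ∧
            -- enumeration of all MAS
            (∀ s : State, IsQueryStart s₁ s →
              Answers W enumerate s fun s' =>
                s'.Enumerates {v | IsMAS w v} (K * (w.length + 1) ^ K)) := by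
  -- Any constant above the factors `400`, `100`, `300`, `720` and the exponents `3`, `4` serves the
  -- time bounds.
  refine ⟨buildCmd, checkCmd, longestCmd, ofLengthCmd, enumerateCmd, 1000, ?_⟩
  intro σ w hσ₁ hσ
  refine ⟨isAcyclic w, bijOn_label w, fun W hK => ?_⟩
  -- Room for the sizes of all tables, which are at most `(n + 1) ^ 3` as `σ ≤ n`, and for the small
  -- constants in the programs.
  have hW : (w.length + 1) ^ 3 + 10 < W := by
    have h1 : 1000 * (w.length + 1) ^ 3 ≤ W :=
      (mul_pow_le (n := w.length) (K := 1000) le_rfl (by omega)).trans hK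
    have h2 : 1 ≤ (w.length + 1) ^ 3 := Nat.pow_pos (Nat.succ_pos _)
    omega
  obtain ⟨s₁, hexec, hclock, hin, hT⟩ := exists_exec_buildCmd hσ₁ hσ hW
  have htime : 300 * (w.length + 1) ^ 4 ≤ 1000 * (w.length + 1) ^ 1000 :=
    mul_pow_le (by omega) (by omega)
  have hstart : ∀ s, IsQueryStart s₁ s → s.arr .input = inputArray w ∧
      IsTable w (s.arr (.data 0)) ∧ s.clock = 0 ∧ s.out = [] := by
    rintro s ⟨⟨h1, h2⟩, h3, h4⟩
    exact ⟨h1.trans hin, by rw [h2]; exact hT, h3, h4⟩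
  refine ⟨s₁, hexec, hclock.trans (Nat.mul_le_mul_right _ (by omega)), hin, hT.storesGraph,
    fun u s hs hu hq => ?_, fun s hs => ?_, fun l s hs hl hq => ?_, fun s hs => ?_⟩ <;>
    obtain ⟨h1, h2, h3, h4⟩ := hstart s hs
  · exact (answers_checkCmd hσ hW h1 h2 h3 h4 u hu hq).mono fun s' h =>
      ⟨h.1.trans (Nat.mul_le_mul_right _ (by omega)), h.2⟩
  · exact (answers_longestCmd hσ₁ hσ hW h1 h2 h3 h4).mono fun s' h => ⟨h.1.trans htime, h.2⟩
  · exact (answers_ofLengthCmd hσ hW h1 h2 h3 h4 l hl hq).mono fun s' h => ⟨h.1.trans htime, h.2⟩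
  · exact (answers_enumerateCmd hσ₁ hσ hW h1 h2 h3 h4).mono fun s' h =>
      h.mono ((delay_le hσ).trans (mul_pow_le (by omega) (by omega)))
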